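/- Let $\Gamma$ be a countably infinite connected graph with weights $\mu_{x,y}=\mu_{y,x}>0$ on its edges $x\sim y$ (and $\mu_{x,y}=0$ otherwise) such that $\mu(x)=\sum_{y\sim x}\mu_{x,y}<\infty$ for every vertex $x$; put $\mu(A)=\sum_{y\in A}\mu(y)$. Let $(X_k)$ be the random walk with transition probabilities $P(x,y)=\mu_{x,y}/\mu(x)$, and $\Delta=P-I$. With $d$ the graph distance, put $B(x,R)=\{y:d(x,y)<R\}$, $V(x,R)=\mu(B(x,R))$ and $v(x,r,R)=V(x,R)-V(x,r)$. For $A\subset\Gamma$ let $T_A=\min\{k\ge 0:X_k\notin A\}$, and let $E(x,R)=\mathbb E(T_{B(x,R)}\mid X_0=x)$. Let $P^A_k$ be the $k$-step transition probabilities of the walk killed on leaving $A$, and let $g^A(x,y)=\frac1{\mu(y)}\sum_{k\ge0}P^A_k(x,y)$ be the local Green kernel. For disjoint $A,B\subset \Gamma$ let $\rho(A,B)=\big(\inf\{\sum_x(-\Delta f)(x)f(x)\mu(x)\}\big)^{-1}$, where the infimum is over the finitely supported $f:\Gamma\to\mathbb R$ with $f=1$ on $A$ and $f=0$ on $B$,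 and let $\rho(x,r,R)=\rho(B(x,r),\Gamma\setminus B(x,R))$. Assume - $(p_0)$: there is $p_0>0$ with $P(x,y)\ge p_0$ whenever $x\sim y$; - $(VD)$: there is $D_V>0$ with $V(x,2R)\le D_V V(x,R)$ for all $x\in\Gamma$ and all real $R>0$. Then the following are equivalent. 1. $(g)$: there are $C,c>0$ such that for all $x\in\Gamma$ and all real $R>0$ $$\max_{y\notin B(x,R)} g^{B(x,2R)}(x,y)\le C\,\frac{E(x,2R)}{V(x,R)},\qquad \min_{y\in B(x,R)} g^{B(x,2R)}(x,y)\ge c\,\frac{E(x,2R)}{V(x,R)}.$$ 2. Both of the following hold. - $(H)$ (elliptic Harnack inequality): there is $H>1$ such that for all $x\in\Gamma$, all real $R>0$ and every $u$ that is non-negative on $B(x,2R)$ and its neighbours and harmonic in $B(x,2R)$ (that is, $\sum_yP(z,y)u(y)=u(z)$ for $z\in B(x,2R)$), $\max_{B(x,R)}u\le H\min_{B(x,R)}u$. - $(ER)$ (Einstein relation): there is $C>0$ such that for all $x\in\Gamma$ and all real $R>1/2$ $$C^{-1}\rho(x,R,2R)\,v(x,R,2R)\le E(x,2R)\le C\,\rho(x,R,2R)\,v(x,R,2R).$$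 -/

import Mathlib

open MeasureTheory ProbabilityTheory
open scoped NNReal ENNReal

/-- A connected weighted graph `(Γ, μ)` on the vertex set `V`: symmetric weights `μ_{x,y}` which are
positive exactly on the edges, and with finite total weight at each vertex. -/
structure WeightedGraph (V : Type*) where
  graph : SimpleGraph V
  connected : graph.Connected
  weight : V → V → ℝ≥0
  weight_symm : ∀ x y, weight x y = weight y x
  weight_pos_iff : ∀ x y, 0 < weight x y ↔ graph.Adj x y
  weight_summable : ∀ x, Summable (weight x)

namespace WeightedGraph

noncomputable section

variable {V : Type*} (W : WeightedGraph V)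

/-- The measure of a vertex, `μ(x) = ∑_y μ_{x,y}`. -/
def vertexMeasure (x : V) : ℝ≥0 := ∑' y, W.weight x y

/-- The measure of a set, `μ(A) = ∑_{y ∈ A} μ(y)`. -/
def setMeasure (A : Set V) : ℝ≥0∞ := ∑' y : A, (W.vertexMeasure y : ℝ≥0∞)

/-- The transition probabilities `P(x,y) = μ_{x,y} / μ(x)`. -/
def transition (x y : V) : ℝ≥0 := W.weight x y / W.vertexMeasure x

/-- The open ball `B(x,R) = {y : d(x,y) < R}` of the shortest path distance. -/
def ball (x : V) (R : ℝ) : Set V := {y | (W.graph.dist x y : ℝ) < R}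

/-- `V(x,R) = μ(B(x,R))`. -/
def vol (x : V) (R : ℝ) : ℝ≥0∞ := W.setMeasure (W.ball x R)

/-- `v(x,r,R) = V(x,R) - V(x,r)`, the volume of an annulus (for `r ≤ R`). -/
def annulusVol (x : V) (r R : ℝ) : ℝ≥0∞ := W.vol x R - W.vol x r

/-- Condition `(p₀)`. -/
def ControlledWeights : Prop :=
  ∃ p₀ : ℝ≥0, 0 < p₀ ∧ ∀ x y, W.graph.Adj x y → p₀ ≤ W.transition x y

/-- Condition `(VD)`, volume doubling. -/
def VolumeDoubling : Prop :=
  ∃ D : ℝ≥0, 0 < D ∧ ∀ (x : V) (R : ℝ), 0 < R → W.vol x (2 * R) ≤ D * W.vol x R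

/-! ### The Laplace operator, harmonic functions, the elliptic Harnack inequality -/

/-- The Markov operator `Pf(x) = ∑_y P(x,y) f(y)`. -/
def markovOp (f : V → ℝ) (x : V) : ℝ := ∑' y, (W.transition x y : ℝ) * f y

/-- The Laplace operator `Δ = P - I`. -/
def laplacian (f : V → ℝ) (x : V) : ℝ := W.markovOp f x - f x

/-- The inner product `(f,g) = ∑_x f(x) g(x) μ(x)` (used when one of the functions has finite
support). -/
def innerMu (f g : V → ℝ) : ℝ := ∑' x, f x * g x * (W.vertexMeasure x : ℝ)

/-- The closure of `A`: the points of `A` and their neighbours. -/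
def closure (A : Set V) : Set V := A ∪ {y | ∃ x ∈ A, W.graph.Adj x y}

/-- `u` is harmonic on `A`: `Pu(x) = u(x)` for `x ∈ A`, where the series `Pu(x)` converges. Only the
values of `u` on the closure of `A` matter. -/
def HarmonicOn (u : V → ℝ) (A : Set V) : Prop :=
  ∀ x ∈ A, HasSum (fun y => (W.transition x y : ℝ) * u y) (u x)

/-- Condition `(H)`, the elliptic Harnack inequality:
`max_{B(x,R)} u ≤ H min_{B(x,R)} u` for every `u` that is harmonic in `B(x,2R)` and non-negative
where it is defined, that is, on the closure of `B(x,2R)`. -/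
def EllipticHarnack : Prop :=
  ∃ H : ℝ, 1 < H ∧ ∀ (x : V) (R : ℝ), 0 < R → ∀ u : V → ℝ,
    W.HarmonicOn u (W.ball x (2 * R)) → (∀ y ∈ W.closure (W.ball x (2 * R)), 0 ≤ u y) →
    ∀ y ∈ W.ball x R, ∀ z ∈ W.ball x R, u y ≤ H * u z

/-! ### The resistance -/

/-- The resistance `ρ(A,B)`, the inverse of the infimum of the energies `(-Δf, f)` over the finitely
supported `f` with `f = 1` on `A` and `f = 0` on `B`. -/
def resistance (A B : Set V) : ℝ≥0∞ :=
  (⨅ (f : V →₀ ℝ) (_ : (∀ x ∈ A, f x = 1) ∧ ∀ x ∈ B, f x = 0),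
    ENNReal.ofReal (W.innerMu (fun x => - W.laplacian f x) f))⁻¹

/-- `ρ(x,r,R) = ρ(B(x,r), Γ - B(x,R))`. -/
def annulusResistance (x : V) (r R : ℝ) : ℝ≥0∞ :=
  W.resistance (W.ball x r) (W.ball x R)ᶜ

/-! ### The local Green kernel -/

open Classical in
/-- The transition probabilities `P^A` of the walk killed on leaving `A`. -/
def killedTransition (A : Set V) (x y : V) : ℝ≥0∞ :=
  if x ∈ A ∧ y ∈ A then (W.transition x y : ℝ≥0∞) else 0

open Classical in
/-- The iterates `P_k^A`; `P_0^A` is the identity on `A`. -/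
def killedIterate (A : Set V) : ℕ → V → V → ℝ≥0∞
  | 0, x, y => if x ∈ A ∧ x = y then 1 else 0
  | k + 1, x, y => ∑' z, W.killedTransition A x z * killedIterate A k z y

/-- The local Green function `G^A(x,y) = ∑_k P_k^A(x,y)`. -/
def greenFunction (A : Set V) (x y : V) : ℝ≥0∞ := ∑' k, W.killedIterate A k x y

/-- The local Green kernel `g^A(x,y) = G^A(x,y) / μ(y)`. -/
def greenKernel (A : Set V) (x y : V) : ℝ≥0∞ := W.greenFunction A x y / W.vertexMeasure y

/-- The exit time `T_A = min {k : X_k ∉ A}` of a path (`∞` if the path stays in `A`). -/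
def exitTime (A : Set V) (ω : ℕ → V) : ℝ≥0∞ := ⨅ (k : ℕ) (_ : ω k ∉ A), (k : ℝ≥0∞)

/-! ### The random walk and the mean exit time -/

theorem vertexMeasure_pos [Infinite V] (x : V) : 0 < W.vertexMeasure x := by
  obtain ⟨y, hy⟩ := W.connected.preconnected.exists_adj_of_nontrivial x
  exact NNReal.tsum_pos (W.weight_summable x) y ((W.weight_pos_iff x y).2 hy)

theorem tsum_transition [Infinite V] (x : V) :
    ∑' y, (W.transition x y : ℝ≥0∞) = 1 := by
  have h0 : W.vertexMeasure x ≠ 0 := (W.vertexMeasure_pos x).ne'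
  have h1 : HasSum (fun y => W.transition x y) 1 := by
    have := (W.weight_summable x).hasSum.div_const (W.vertexMeasure x)
    rwa [← vertexMeasure, div_self h0] at this
  exact (ENNReal.hasSum_coe.2 h1).tsum_eq

/-- The law `P(x, ·)` of one step of the walk from `x`. -/
def stepLaw [Infinite V] (x : V) : PMF V :=
  ⟨fun y => (W.transition x y : ℝ≥0∞), W.tsum_transition x ▸ ENNReal.summable.hasSum⟩

variable [Infinite V] [Countable V] [MeasurableSpace V] [DiscreteMeasurableSpace V]

/-- The one-step kernel, as a kernel from the history `(X_0, …, X_n)` to `X_{n+1}`; it depends on the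
last position `X_n` only. -/
def stepKernel (n : ℕ) : Kernel (Finset.Iic n → V) V :=
  (Kernel.ofFunOfCountable fun x => (W.stepLaw x).toMeasure).comap
    (fun h => h ⟨n, Finset.mem_Iic.2 le_rfl⟩) (measurable_pi_apply _)

instance (n : ℕ) : IsMarkovKernel (W.stepKernel n) :=
  ⟨fun h => PMF.toMeasure.isProbabilityMeasure (W.stepLaw (h ⟨n, Finset.mem_Iic.2 le_rfl⟩))⟩

/-- The law on path space of the random walk `(X_k)` with `X_0 = z`. -/
def walkLaw (z : V) : Measure (ℕ → V) :=
  Kernel.traj (X := fun _ => V) W.stepKernel 0 (fun _ => z)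

/-- `E_z(A) = 𝔼(T_A | X_0 = z)`. -/
def meanExitFrom (z : V) (A : Set V) : ℝ≥0∞ := ∫⁻ ω, exitTime A ω ∂(W.walkLaw z)

/-- `E(x,R) = E_x(B(x,R))`. -/
def meanExit (x : V) (R : ℝ) : ℝ≥0∞ := W.meanExitFrom x (W.ball x R)

/-- Condition `(ER)`, the Einstein relation `E(x,2R) ≃ ρ(x,R,2R) v(x,R,2R)`, for `R > 1/2`; for
`R ≤ 1/2` the balls `B(x,R)` and `B(x,2R)` are both `{x}`, and the annulus is empty. -/
def EinsteinRelation : Prop :=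
  ∃ C : ℝ≥0, 0 < C ∧ ∀ (x : V) (R : ℝ), 1 / 2 < R →
    W.meanExit x (2 * R) ≤ C * (W.annulusResistance x R (2 * R) * W.annulusVol x R (2 * R)) ∧
    W.annulusResistance x R (2 * R) * W.annulusVol x R (2 * R) ≤ C * W.meanExit x (2 * R)

/-- Condition `(g)`, the two-sided bounds
`max_{y ∉ B(x,R)} g^{B(x,2R)}(x,y) ≤ C E(x,2R) / V(x,R)` and
`min_{y ∈ B(x,R)} g^{B(x,2R)}(x,y) ≥ c E(x,2R) / V(x,R)`. -/
def GreenKernelBounds : Prop :=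
  ∃ C c : ℝ≥0, 0 < C ∧ 0 < c ∧ ∀ (x : V) (R : ℝ), 0 < R →
    (⨆ y ∈ (W.ball x R)ᶜ, W.greenKernel (W.ball x (2 * R)) x y)
      ≤ C * (W.meanExit x (2 * R) / W.vol x R) ∧
    c * (W.meanExit x (2 * R) / W.vol x R)
      ≤ ⨅ y ∈ W.ball x R, W.greenKernel (W.ball x (2 * R)) x y

end

end WeightedGraph

/-!
By `(p₀)` balls are finite, so everything reduces to Dirichlet problems on finite sets for the
weighted Laplacian `Δ_μ u(x) = ∑_y μ_{x,y} (u(y) - u(x))`: the Green kernel `g^A(x,·)` vanishes off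
`A` and satisfies `Δ_μ g^A(x,·) = -δ_x` in `A`, `E(x,R) = ∑_y g^{B(x,R)}(x,y) μ(y)`, and the maximum
principle compares solutions.

If the values of `g^{B(x,2R)}(x,·)` on the sphere of radius `⌈R⌉` are comparable, then by the
maximum principle and the variational formula for `ρ` they are comparable to `ρ(x,R,2R)`. Under
`(H)` this is obtained by chaining the Harnack inequality along geodesics that stay away from the
pole, and `(ER)` turns `ρ(x,R,2R)` into `E(x,2R)/V(x,R)`, which is `(g)`. Conversely `(g)` bounds
`ρ(x,R,2R)` by `E(x,2R)/V(x,R)` on both sides, and `v(x,R,2R)` is comparable to `V(x,R)` by `(VD)`,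
which is `(ER)`.

For `(H)`, a function that is harmonic and nonnegative in `B(x,2r)` is a Green potential of a charge
near the boundary, so it suffices to compare `g^{B(x,2r)}(a,z)` and `g^{B(x,2r)}(b,z)` for poles
`a, b` near `x` and `z` far from them. Around `z`, `(g)` bounds the first by `E(z,4r)/V(z,2r)`, and
it bounds the second from below by `E(z,r/4)/V(z,r/8)` near `z`; this lower bound propagates to `b`,
because by `(g)` a nonnegative superharmonic function that is large on a ball remains large on the
ball of twice the radius. The same propagation bounds exit probabilities from below, and thereby
shows that `E(z,2r)/V(z,r)` grows at most by a constant factor when `r` is doubled.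
-/

namespace WeightedGraph

section ExitTime

variable {V : Type*} (W : WeightedGraph V)

theorem killedIterate_zero_of_ne (A : Set V) {x y : V} (h : x ≠ y) :
    W.killedIterate A 0 x y = 0 := by
  simp [killedIterate, h]

theorem killedIterate_zero_self {A : Set V} {x : V} (hx : x ∈ A) :
    W.killedIterate A 0 x x = 1 := by
  simp [killedIterate, hx]

theorem killedTransition_of_notMem_left {A : Set V} {x : V} (hx : x ∉ A) (y : V) :
    W.killedTransition A x y = 0 := by
  simp [killedTransition, hx]

theorem killedTransition_of_notMem_right {A : Set V} (x : V) {y : V} (hy : y ∉ A) :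
    W.killedTransition A x y = 0 := by
  simp [killedTransition, hy]

theorem killedTransition_of_mem {A : Set V} {x y : V} (hx : x ∈ A) (hy : y ∈ A) :
    W.killedTransition A x y = W.transition x y := by
  simp [killedTransition, hx, hy]

theorem killedIterate_of_notMem_left {A : Set V} {x : V} (hx : x ∉ A) (k : ℕ) (y : V) :
    W.killedIterate A k x y = 0 := by
  cases k <;> simp [killedIterate, killedTransition_of_notMem_left, hx]

theorem killedIterate_of_notMem_right {A : Set V} {y : V} (hy : y ∉ A) (k : ℕ) (x : V) :
    W.killedIterate A k x y = 0 := by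
  induction k generalizing x with
  | zero => exact if_neg fun ⟨hx, hxy⟩ => hy (hxy ▸ hx)
  | succ k ih => simp [killedIterate, ih]

theorem tsum_killedIterate_zero_mul (A : Set V) (x : V) (f : V → ℝ≥0∞) :
    ∑' y, W.killedIterate A 0 x y * f y = A.indicator f x := by
  rw [tsum_eq_single x fun y hy => by rw [W.killedIterate_zero_of_ne A hy.symm, zero_mul]]
  by_cases hx : x ∈ A
  · rw [W.killedIterate_zero_self hx, one_mul, Set.indicator_of_mem hx]
  · rw [W.killedIterate_of_notMem_left hx, zero_mul, Set.indicator_of_notMem hx]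

theorem tsum_killedIterate_succ_mul (A : Set V) (k : ℕ) (x : V) (f : V → ℝ≥0∞) :
    ∑' y, W.killedIterate A (k + 1) x y * f y
      = ∑' z, W.killedTransition A x z * ∑' y, W.killedIterate A k z y * f y := by
  simp_rw [killedIterate, ← ENNReal.tsum_mul_right, ← ENNReal.tsum_mul_left]
  rw [ENNReal.tsum_comm]
  simp_rw [mul_assoc]

theorem tsum_killedIterate_succ_mul' (A : Set V) (k : ℕ) (x : V) (f : V → ℝ≥0∞) :
    ∑' y, W.killedIterate A (k + 1) x y * f y
      = ∑' z, W.killedIterate A k x z * ∑' y, W.killedTransition A z y * f y := by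
  induction k generalizing x with
  | zero =>
    rw [tsum_killedIterate_succ_mul, tsum_killedIterate_zero_mul]
    by_cases hx : x ∈ A
    · rw [Set.indicator_of_mem hx]
      refine tsum_congr fun z => ?_
      rw [tsum_killedIterate_zero_mul]
      by_cases hz : z ∈ A
      · rw [Set.indicator_of_mem hz]
      · rw [W.killedTransition_of_notMem_right x hz, zero_mul, zero_mul]
    · simp [Set.indicator_of_notMem hx, W.killedTransition_of_notMem_left hx]
  | succ k ih =>
    rw [tsum_killedIterate_succ_mul]
    simp_rw [ih]
    rw [tsum_killedIterate_succ_mul]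

theorem exitTime_eq_tsum (A : Set V) (ω : ℕ → V) :
    exitTime A ω = ∑' k, ∏ i ∈ Finset.range (k + 1), A.indicator 1 (ω i) := by
  classical
  by_cases hexit : ∃ k, ω k ∉ A
  · have hstay : ∀ i < Nat.find hexit, ω i ∈ A := fun i hi => not_not.1 (Nat.find_min hexit hi)
    have htime : exitTime A ω = Nat.find hexit := by
      refine le_antisymm (iInf₂_le (Nat.find hexit) (Nat.find_spec hexit)) (le_iInf₂ fun i hi => ?_)
      exact_mod_cast not_lt.1 fun hlt => hi (hstay i hlt)
    rw [htime, tsum_eq_sum (s := Finset.range (Nat.find hexit)) fun k hk =>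
      Finset.prod_eq_zero (i := Nat.find hexit)
        (Finset.mem_range.2 (Nat.lt_succ_of_le (not_lt.1 (mt Finset.mem_range.2 hk))))
        (Set.indicator_of_notMem (Nat.find_spec hexit) _),
      Finset.sum_congr rfl fun k hk => Finset.prod_eq_one fun i hi => Set.indicator_of_mem
        (hstay i ((Nat.lt_succ_iff.1 (Finset.mem_range.1 hi)).trans_lt (Finset.mem_range.1 hk))) _]
    simp
  · push Not at hexit
    simp [exitTime, hexit]

variable [Infinite V] [Countable V] [MeasurableSpace V] [DiscreteMeasurableSpace V]

theorem lintegral_walkLaw_zero (z : V) (f : V → ℝ≥0∞) : ∫⁻ ω, f (ω 0) ∂(W.walkLaw z) = f z := by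
  let g : (Finset.Iic 0 → V) → ℝ≥0∞ := fun h => f (h ⟨0, Finset.mem_Iic.2 le_rfl⟩)
  have hmap := lintegral_map (μ := W.walkLaw z) (f := g) .of_discrete
    (Preorder.measurable_frestrictLe (X := fun _ : ℕ => V) 0)
  rw [walkLaw, Kernel.traj_map_frestrictLe_apply, Kernel.partialTraj_self, Kernel.id_apply,
    lintegral_dirac] at hmap
  exact hmap.symm

theorem lintegral_stepLaw (x : V) (f : V → ℝ≥0∞) :
    ∫⁻ y, f y ∂(W.stepLaw x).toMeasure = ∑' y, (W.transition x y : ℝ≥0∞) * f y := by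
  rw [lintegral_countable']
  refine tsum_congr fun y => ?_
  rw [PMF.toMeasure_apply_singleton _ _ (MeasurableSet.singleton y), mul_comm]
  rfl

theorem lintegral_markovProperty (z : V) (k : ℕ) (g : (Finset.Iic k → V) → ℝ≥0∞) (f : V → ℝ≥0∞) :
    ∫⁻ ω, g (Preorder.frestrictLe k ω) * f (ω (k + 1)) ∂(W.walkLaw z)
      = ∫⁻ ω, g (Preorder.frestrictLe k ω) * ∑' y, (W.transition (ω k) y : ℝ≥0∞) * f y
          ∂(W.walkLaw z) := by
  have hpair : Measurable fun ω : ℕ → V =>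
      (Preorder.frestrictLe (π := fun _ => V) k ω, ω (k + 1)) := by fun_prop
  have hstep : ∀ h, ∫⁻ y, g h * f y ∂(W.stepKernel k h)
      = g h * ∑' y, (W.transition (h ⟨k, Finset.mem_Iic.2 le_rfl⟩) y : ℝ≥0∞) * f y := fun h => by
    rw [lintegral_const_mul _ .of_discrete, ← lintegral_stepLaw]
    rfl
  calc ∫⁻ ω, g (Preorder.frestrictLe k ω) * f (ω (k + 1)) ∂(W.walkLaw z)
      = ∫⁻ h, ∫⁻ y, g h * f y ∂(W.stepKernel k h)
          ∂(Kernel.partialTraj (X := fun _ => V) W.stepKernel 0 k (fun _ => z)) := by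
        have h := Kernel.partialTraj_compProd_eq_map_traj (X := fun _ => V) (κ := W.stepKernel)
          (Nat.zero_le k) (x₀ := fun _ => z)
        rw [walkLaw, ← Measure.lintegral_compProd (f := fun p => g p.1 * f p.2) .of_discrete, h,
          lintegral_map .of_discrete hpair]
    _ = _ := by
        simp_rw [hstep]
        rw [← Kernel.traj_map_frestrictLe_apply, lintegral_map .of_discrete
          (Preorder.measurable_frestrictLe _)]
        rfl

theorem lintegral_prod_indicator (A : Set V) (k : ℕ) (z : V) (f : V → ℝ≥0∞) :
    ∫⁻ ω, (∏ i ∈ Finset.range (k + 1), A.indicator 1 (ω i)) * f (ω k) ∂(W.walkLaw z)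
      = ∑' y, W.killedIterate A k z y * f y := by
  induction k generalizing f with
  | zero =>
    rw [tsum_killedIterate_zero_mul, ← W.lintegral_walkLaw_zero z (A.indicator f)]
    refine lintegral_congr fun ω => ?_
    by_cases h : ω 0 ∈ A <;> simp [h]
  | succ k ih =>
    let survive : (Finset.Iic k → V) → ℝ≥0∞ := fun h =>
      ∏ i : Finset.Iic k, A.indicator 1 (h i)
    have hsurvive : ∀ ω : ℕ → V, survive (Preorder.frestrictLe k ω)
        = ∏ i ∈ Finset.range (k + 1), A.indicator 1 (ω i) := fun ω => by
      rw [Nat.range_succ_eq_Iic]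
      exact Finset.prod_coe_sort (Finset.Iic k) fun i => A.indicator 1 (ω i)
    calc _ = ∫⁻ ω, survive (Preorder.frestrictLe k ω) * A.indicator f (ω (k + 1))
            ∂(W.walkLaw z) := by
          refine lintegral_congr fun ω => ?_
          rw [hsurvive, Finset.prod_range_succ, mul_assoc, ← Set.indicator_mul_left]
          simp
      _ = ∑' x, W.killedIterate A k z x
            * ∑' y, (W.transition x y : ℝ≥0∞) * A.indicator f y := by
          rw [lintegral_markovProperty]
          simp_rw [hsurvive]
          exact ih fun x => ∑' y, (W.transition x y : ℝ≥0∞) * A.indicator f y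
      _ = ∑' x, W.killedIterate A k z x * ∑' y, W.killedTransition A x y * f y := by
          refine tsum_congr fun x => ?_
          by_cases hx : x ∈ A
          · congr 1
            refine tsum_congr fun y => ?_
            by_cases hy : y ∈ A <;> simp [killedTransition, hx, hy]
          · rw [W.killedIterate_of_notMem_right hx, zero_mul, zero_mul]
      _ = _ := (W.tsum_killedIterate_succ_mul' A k z f).symm

theorem meanExitFrom_eq_tsum (A : Set V) (z : V) :
    W.meanExitFrom z A = ∑' y, W.greenFunction A z y := by
  have hmeas : ∀ k, Measurable fun ω : ℕ → V =>
      ∏ i ∈ Finset.range (k + 1), A.indicator (1 : V → ℝ≥0∞) (ω i) := fun k =>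
    Finset.measurable_fun_prod _ fun i _ =>
      (Measurable.of_discrete (f := A.indicator (1 : V → ℝ≥0∞))).comp (measurable_pi_apply i)
  simp_rw [meanExitFrom, greenFunction, exitTime_eq_tsum]
  rw [lintegral_tsum fun k => (hmeas k).aemeasurable, ENNReal.tsum_comm]
  exact tsum_congr fun k => by simpa using W.lintegral_prod_indicator A k z 1

end ExitTime

section PotentialTheory

variable {V : Type*} (W : WeightedGraph V)

/-- The weight `μ_{x,y}` as a real number. -/
noncomputable def conductance (x y : V) : ℝ := W.weight x y

/-- The measure `μ(x)` of a vertex as a real number. -/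
noncomputable def mass (x : V) : ℝ := W.vertexMeasure x

theorem conductance_nonneg (x y : V) : 0 ≤ W.conductance x y := NNReal.coe_nonneg _

theorem conductance_comm (x y : V) : W.conductance x y = W.conductance y x := by
  rw [conductance, conductance, W.weight_symm]

theorem conductance_pos {x y : V} (h : W.graph.Adj x y) : 0 < W.conductance x y :=
  NNReal.coe_pos.2 ((W.weight_pos_iff x y).2 h)

theorem conductance_eq_zero {x y : V} (h : ¬ W.graph.Adj x y) : W.conductance x y = 0 :=
  (not_lt.1 fun hpos => h ((W.weight_pos_iff x y).1 (NNReal.coe_pos.1 hpos))).antisymm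
    (W.conductance_nonneg x y)

theorem coe_transition (x y : V) : (W.transition x y : ℝ) = W.conductance x y / W.mass x :=
  NNReal.coe_div _ _

theorem mass_nonneg (x : V) : 0 ≤ W.mass x := NNReal.coe_nonneg _

theorem mass_pos [Infinite V] (x : V) : 0 < W.mass x := NNReal.coe_pos.2 (W.vertexMeasure_pos x)

theorem sum_conductance_le_mass (S : Finset V) (x : V) :
    ∑ y ∈ S, W.conductance x y ≤ W.mass x := by
  have h := (W.weight_summable x).sum_le_tsum S fun _ _ => zero_le
  rw [← vertexMeasure, ← NNReal.coe_le_coe, NNReal.coe_sum] at h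
  exact h

section Laplacian

variable [W.graph.LocallyFinite]

theorem sum_conductance_neighborFinset (x : V) :
    ∑ y ∈ W.graph.neighborFinset x, W.conductance x y = W.mass x := by
  have h : ∀ y ∉ W.graph.neighborFinset x, W.weight x y = 0 := fun y hy =>
    NNReal.coe_eq_zero.1 (W.conductance_eq_zero fun hadj =>
      hy ((W.graph.mem_neighborFinset x y).2 hadj))
  rw [mass, vertexMeasure, tsum_eq_sum h, NNReal.coe_sum]
  rfl

/-- The operator `μΔ`, that is `u ↦ ∑_y μ_{x,y} (u(y) - u(x))`. Unlike `Δ` it is symmetric for the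
counting measure, so that summation by parts involves no weights. -/
noncomputable def muLaplacian : (V → ℝ) →ₗ[ℝ] V → ℝ where
  toFun u x := ∑ y ∈ W.graph.neighborFinset x, W.conductance x y * (u y - u x)
  map_add' u v := by
    ext x
    simp only [Pi.add_apply, ← Finset.sum_add_distrib]
    exact Finset.sum_congr rfl fun y _ => by ring
  map_smul' a u := by
    ext x
    simp only [Pi.smul_apply, smul_eq_mul, RingHom.id_apply, Finset.mul_sum]
    exact Finset.sum_congr rfl fun y _ => by ring

theorem muLaplacian_apply (u : V → ℝ) (x : V) :
    W.muLaplacian u x = ∑ y ∈ W.graph.neighborFinset x, W.conductance x y * (u y - u x) := rfl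

theorem muLaplacian_eq_sum_sub (u : V → ℝ) (x : V) : W.muLaplacian u x
    = ∑ y ∈ W.graph.neighborFinset x, W.conductance x y * u y - W.mass x * u x := by
  simp only [muLaplacian_apply, mul_sub, Finset.sum_sub_distrib, ← Finset.sum_mul,
    sum_conductance_neighborFinset]

theorem muLaplacian_eq_sum_sub_of_support {S : Finset V} {u : V → ℝ} (hu : ∀ y ∉ S, u y = 0)
    (x : V) : W.muLaplacian u x = ∑ y ∈ S, W.conductance x y * u y - W.mass x * u x := by
  classical
  have hnbr : ∀ y ∉ W.graph.neighborFinset x, W.conductance x y * u y = 0 := fun y hy => by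
    rw [W.conductance_eq_zero (mt (W.graph.mem_neighborFinset x y).2 hy), zero_mul]
  have hsupp : ∀ y ∉ S, W.conductance x y * u y = 0 := fun y hy => by rw [hu y hy, mul_zero]
  rw [muLaplacian_eq_sum_sub,
    Finset.sum_subset (Finset.subset_union_left (s₂ := S)) fun y _ hy => hnbr y hy,
    ← Finset.sum_subset Finset.subset_union_right fun y _ hy => hsupp y hy]

theorem muLaplacian_const (a : ℝ) (x : V) : W.muLaplacian (fun _ => a) x = 0 := by
  simp [muLaplacian_apply]

theorem muLaplacian_congr {u v : V → ℝ} {x : V} (hx : u x = v x)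
    (h : ∀ y, W.graph.Adj x y → u y = v y) : W.muLaplacian u x = W.muLaplacian v x := by
  rw [muLaplacian_apply, muLaplacian_apply]
  exact Finset.sum_congr rfl fun y hy => by
    rw [hx, h y ((W.graph.mem_neighborFinset x y).1 hy)]

theorem muLaplacian_mono {u v : V → ℝ} {x : V} (hx : u x = v x)
    (h : ∀ y, W.graph.Adj x y → u y ≤ v y) : W.muLaplacian u x ≤ W.muLaplacian v x :=
  Finset.sum_le_sum fun y hy => mul_le_mul_of_nonneg_left
    (by linarith [h y ((W.graph.mem_neighborFinset x y).1 hy)]) (W.conductance_nonneg x y)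

theorem muLaplacian_nonpos_of_le {u : V → ℝ} {x : V} (h : ∀ y, W.graph.Adj x y → u y ≤ u x) :
    W.muLaplacian u x ≤ 0 := by
  rw [← W.muLaplacian_const (u x) x]
  exact W.muLaplacian_mono rfl h

theorem muLaplacian_min_const_nonpos {u : V → ℝ} {x : V} (h : W.muLaplacian u x ≤ 0) (M : ℝ) :
    W.muLaplacian (fun y => min (u y) M) x ≤ 0 := by
  rcases le_total (u x) M with hx | hx
  · exact (W.muLaplacian_mono (min_eq_left hx) fun y _ => min_le_left _ _).trans h
  · refine W.muLaplacian_nonpos_of_le fun y _ => ?_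
    rw [min_eq_right hx]
    exact min_le_right _ _

theorem sum_mul_muLaplacian_comm {S : Finset V} {f g : V → ℝ} (hf : ∀ y ∉ S, f y = 0)
    (hg : ∀ y ∉ S, g y = 0) :
    ∑ x ∈ S, f x * W.muLaplacian g x = ∑ x ∈ S, g x * W.muLaplacian f x := by
  simp only [W.muLaplacian_eq_sum_sub_of_support hf, W.muLaplacian_eq_sum_sub_of_support hg,
    mul_sub, Finset.sum_sub_distrib, Finset.mul_sum]
  congr 1
  · rw [Finset.sum_comm]
    refine Finset.sum_congr rfl fun x _ => Finset.sum_congr rfl fun y _ => ?_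
    rw [W.conductance_comm y x]
    ring
  · exact Finset.sum_congr rfl fun x _ => by ring

theorem sum_muLaplacian_nonpos {S : Finset V} {f : V → ℝ} (hf : ∀ y ∉ S, f y = 0)
    (hnonneg : ∀ y, 0 ≤ f y) : ∑ x ∈ S, W.muLaplacian f x ≤ 0 := by
  have hflow : ∑ x ∈ S, W.muLaplacian f x
      = ∑ y ∈ S, f y * (∑ x ∈ S, W.conductance y x - W.mass y) := by
    simp only [W.muLaplacian_eq_sum_sub_of_support hf, mul_sub, Finset.sum_sub_distrib,
      Finset.mul_sum]
    rw [Finset.sum_comm]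
    simp only [W.conductance_comm, mul_comm]
  rw [hflow]
  exact Finset.sum_nonpos fun y _ => mul_nonpos_of_nonneg_of_nonpos (hnonneg y)
    (sub_nonpos.2 (W.sum_conductance_le_mass S y))

theorem sum_mul_muLaplacian_self_nonpos {S : Finset V} {f : V → ℝ} (hf : ∀ y ∉ S, f y = 0) :
    ∑ x ∈ S, f x * W.muLaplacian f x ≤ 0 := by
  have hcross : ∑ x ∈ S, f x * W.muLaplacian f x
      = ∑ x ∈ S, ∑ y ∈ S, W.conductance x y * (f x * f y) - ∑ x ∈ S, W.mass x * f x ^ 2 := by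
    simp only [W.muLaplacian_eq_sum_sub_of_support hf, mul_sub, Finset.sum_sub_distrib,
      Finset.mul_sum]
    congr 1
    · exact Finset.sum_congr rfl fun x _ => Finset.sum_congr rfl fun y _ => by ring
    · exact Finset.sum_congr rfl fun x _ => by ring
  have hsymm : ∑ x ∈ S, ∑ y ∈ S, W.conductance x y * f y ^ 2
      = ∑ x ∈ S, ∑ y ∈ S, W.conductance x y * f x ^ 2 := by
    rw [Finset.sum_comm]
    simp only [W.conductance_comm]
  have hmass : ∑ x ∈ S, ∑ y ∈ S, W.conductance x y * f x ^ 2 ≤ ∑ x ∈ S, W.mass x * f x ^ 2 :=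
    Finset.sum_le_sum fun x _ => by
      rw [← Finset.sum_mul]
      exact mul_le_mul_of_nonneg_right (W.sum_conductance_le_mass S x) (sq_nonneg _)
  have hsquare : 0 ≤ ∑ x ∈ S, ∑ y ∈ S, W.conductance x y * (f x - f y) ^ 2 :=
    Finset.sum_nonneg fun x _ => Finset.sum_nonneg fun y _ =>
      mul_nonneg (W.conductance_nonneg x y) (sq_nonneg _)
  have hexpand : ∑ x ∈ S, ∑ y ∈ S, W.conductance x y * (f x - f y) ^ 2
      = ∑ x ∈ S, ∑ y ∈ S, W.conductance x y * f x ^ 2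
        - 2 * ∑ x ∈ S, ∑ y ∈ S, W.conductance x y * (f x * f y)
        + ∑ x ∈ S, ∑ y ∈ S, W.conductance x y * f y ^ 2 := by
    simp only [Finset.mul_sum, ← Finset.sum_sub_distrib, ← Finset.sum_add_distrib]
    exact Finset.sum_congr rfl fun x _ => Finset.sum_congr rfl fun y _ => by ring
  linarith

variable [Infinite V]

/- Follow a walk from a minimum point of `u` to a point where `u` is not minimal. -/
theorem nonneg_of_muLaplacian_nonpos {A : Finset V} {u : V → ℝ}
    (hsup : ∀ x ∈ A, W.muLaplacian u x ≤ 0)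
    (hbdry : ∀ x ∈ A, ∀ y, W.graph.Adj x y → y ∉ A → 0 ≤ u y) : ∀ x ∈ A, 0 ≤ u x := by
  by_contra! hneg
  obtain ⟨x, hxA, hx⟩ := hneg
  obtain ⟨a, haA, hmin⟩ := A.exists_min_image u ⟨x, hxA⟩
  have ha : u a < 0 := (hmin x hxA).trans_lt hx
  let M : Set V := {y | y ∈ A ∧ u y = u a}
  obtain ⟨b, hb⟩ : ∃ b, b ∉ M := (A.finite_toSet.subset fun y hy => hy.1).exists_notMem
  obtain ⟨w⟩ := W.connected.preconnected a b
  obtain ⟨d, -, ⟨hdA, hd⟩, hd'⟩ := w.exists_boundary_dart M ⟨haA, rfl⟩ hb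
  have hge : ∀ y, W.graph.Adj d.fst y → u d.fst ≤ u y := fun y hy => by
    rw [hd]
    by_cases hyA : y ∈ A
    · exact hmin y hyA
    · exact ha.le.trans (hbdry _ hdA y hy hyA)
  have hgt : u d.fst < u d.snd := by
    refine (hge _ d.adj).lt_of_ne fun heq => hd' ⟨by_contra fun hout => ?_, heq.symm.trans hd⟩
    linarith [hbdry _ hdA _ d.adj hout]
  refine (hsup _ hdA).not_gt (Finset.sum_pos' (fun y hy => ?_) ⟨d.snd, ?_, ?_⟩)
  · exact mul_nonneg (W.conductance_nonneg _ _)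
      (sub_nonneg.2 (hge y ((W.graph.mem_neighborFinset _ y).1 hy)))
  · exact (W.graph.mem_neighborFinset _ _).2 d.adj
  · exact mul_pos (W.conductance_pos d.adj) (sub_pos.2 hgt)

theorem le_of_muLaplacian_le {A : Finset V} {u v : V → ℝ}
    (hsup : ∀ x ∈ A, W.muLaplacian v x ≤ W.muLaplacian u x)
    (hbdry : ∀ x ∈ A, ∀ y, W.graph.Adj x y → y ∉ A → u y ≤ v y) : ∀ x ∈ A, u x ≤ v x := fun x hx =>
  sub_nonneg.1 (W.nonneg_of_muLaplacian_nonpos (u := v - u)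
    (fun z hz => by rw [map_sub, Pi.sub_apply]; linarith [hsup z hz])
    (fun z hz y hzy hy => sub_nonneg.2 (hbdry z hz y hzy hy)) x hx)

theorem exists_muLaplacian_eq (A : Finset V) (k : V → ℝ) :
    ∃ s : V → ℝ, (∀ z ∉ A, s z = 0) ∧ ∀ x ∈ A, W.muLaplacian s x = k x := by
  let extend : (A → ℝ) →ₗ[ℝ] V → ℝ := Function.ExtendByZero.linearMap ℝ (Subtype.val : A → V)
  have hextend_mem : ∀ (f : A → ℝ) (x : A), extend f x = f x := fun f x =>
    Subtype.val_injective.extend_apply f (0 : V → ℝ) x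
  have hextend_notMem : ∀ (f : A → ℝ), ∀ z ∉ A, extend f z = 0 := fun f z hz =>
    Function.extend_apply' f (0 : V → ℝ) z fun ⟨x, hx⟩ => hz (hx ▸ x.2)
  let T : (A → ℝ) →ₗ[ℝ] (A → ℝ) := LinearMap.funLeft ℝ ℝ Subtype.val ∘ₗ W.muLaplacian ∘ₗ extend
  have hinj : Function.Injective T := (injective_iff_map_eq_zero T).2 fun f hf => by
    have hlap : ∀ x ∈ A, W.muLaplacian (extend f) x = 0 := fun x hx => congrFun hf ⟨x, hx⟩
    have hnonneg := W.le_of_muLaplacian_le (A := A) (u := fun _ => 0) (v := extend f)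
      (fun x hx => by rw [hlap x hx, muLaplacian_const])
      (fun x _ y _ hy => (hextend_notMem f y hy).ge)
    have hnonpos := W.le_of_muLaplacian_le (A := A) (v := fun _ => 0) (u := extend f)
      (fun x hx => by rw [hlap x hx, muLaplacian_const])
      (fun x _ y _ hy => (hextend_notMem f y hy).le)
    ext x
    exact (hextend_mem f x).symm.trans ((hnonpos x x.2).antisymm (hnonneg x x.2))
  obtain ⟨f, hf⟩ := LinearMap.injective_iff_surjective.1 hinj fun x => k x
  exact ⟨extend f, hextend_notMem f, fun x hx => congrFun hf ⟨x, hx⟩⟩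

end Laplacian

end PotentialTheory

section GreenKernel

variable {V : Type*} (W : WeightedGraph V)

theorem greenFunction_eq (A : Set V) (x y : V) :
    W.greenFunction A x y = W.killedIterate A 0 x y
      + ∑' z, W.killedTransition A x z * W.greenFunction A z y := by
  simp only [greenFunction]
  rw [tsum_eq_zero_add' ENNReal.summable]
  simp_rw [← ENNReal.tsum_mul_left]
  rw [ENNReal.tsum_comm]
  rfl

theorem greenFunction_of_notMem_left {A : Set V} {x : V} (hx : x ∉ A) (y : V) :
    W.greenFunction A x y = 0 :=
  ENNReal.tsum_eq_zero.2 fun k => W.killedIterate_of_notMem_left hx k y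

theorem greenFunction_of_notMem_right {A : Set V} (x : V) {y : V} (hy : y ∉ A) :
    W.greenFunction A x y = 0 :=
  ENNReal.tsum_eq_zero.2 fun k => W.killedIterate_of_notMem_right hy k x

theorem greenFunction_le {A : Set V} {y : V} {s : V → ℝ≥0∞}
    (hs : ∀ x ∈ A, W.killedIterate A 0 x y + ∑' z, W.killedTransition A x z * s z ≤ s x)
    (x : V) : W.greenFunction A x y ≤ s x := by
  refine ENNReal.tsum_le_of_sum_range_le fun n => ?_
  induction n generalizing x with
  | zero => simp
  | succ n ih =>
    by_cases hx : x ∈ A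
    · refine le_trans ?_ (hs x hx)
      rw [Finset.sum_range_succ', add_comm]
      gcongr
      simp only [killedIterate]
      rw [← Summable.tsum_finsetSum fun _ _ => ENNReal.summable]
      simp_rw [← Finset.mul_sum]
      gcongr
      exact ih _
    · exact (Finset.sum_eq_zero fun k _ => W.killedIterate_of_notMem_left hx k y).trans_le zero_le

/-- The local Green kernel `g^A` of a finite set, with real values. -/
noncomputable def green (A : Finset V) (x y : V) : ℝ := (W.greenKernel (A : Set V) x y).toReal

theorem green_nonneg (A : Finset V) (x y : V) : 0 ≤ W.green A x y := ENNReal.toReal_nonneg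

theorem green_of_notMem_left {A : Finset V} {x : V} (hx : x ∉ A) (y : V) : W.green A x y = 0 := by
  rw [green, greenKernel, W.greenFunction_of_notMem_left (mt Finset.mem_coe.1 hx), ENNReal.zero_div,
    ENNReal.toReal_zero]

theorem green_of_notMem_right {A : Finset V} (x : V) {y : V} (hy : y ∉ A) :
    W.green A x y = 0 := by
  rw [green, greenKernel, W.greenFunction_of_notMem_right x (mt Finset.mem_coe.1 hy),
    ENNReal.zero_div, ENNReal.toReal_zero]

variable [W.graph.LocallyFinite] [Infinite V]

section FirstStep

variable {A : Finset V} {x : V} {s : V → ℝ}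

theorem sum_transition_mul (hs : ∀ z ∉ A, s z = 0) :
    ∑ z ∈ A, (W.transition x z : ℝ) * s z = s x + W.muLaplacian s x / W.mass x := by
  have hmass := (W.mass_pos x).ne'
  simp only [W.muLaplacian_eq_sum_sub_of_support hs, coe_transition, sub_div,
    mul_div_cancel_left₀ _ hmass, Finset.sum_div, div_mul_eq_mul_div]
  ring

theorem add_muLaplacian_div_mass_nonneg (hs : ∀ z ∉ A, s z = 0) (hnonneg : ∀ z, 0 ≤ s z) :
    0 ≤ s x + W.muLaplacian s x / W.mass x := by
  rw [← W.sum_transition_mul hs]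
  exact Finset.sum_nonneg fun z _ => mul_nonneg (NNReal.coe_nonneg _) (hnonneg z)

theorem tsum_killedTransition_mul_ofReal (hx : x ∈ A) (hs : ∀ z ∉ A, s z = 0)
    (hnonneg : ∀ z, 0 ≤ s z) :
    ∑' z, W.killedTransition (A : Set V) x z * ENNReal.ofReal (s z)
      = ENNReal.ofReal (s x + W.muLaplacian s x / W.mass x) := by
  rw [← W.sum_transition_mul hs, ENNReal.ofReal_sum_of_nonneg fun z _ =>
      mul_nonneg (NNReal.coe_nonneg _) (hnonneg z), tsum_eq_sum (s := A) fun z hz => by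
      rw [W.killedTransition_of_notMem_right x (mt Finset.mem_coe.1 hz), zero_mul]]
  refine Finset.sum_congr rfl fun z hz => ?_
  rw [W.killedTransition_of_mem (Finset.mem_coe.2 hx) (Finset.mem_coe.2 hz),
    ENNReal.ofReal_mul (NNReal.coe_nonneg _), ENNReal.ofReal_coe_nnreal]

theorem killedIterate_zero_add_tsum_ofReal [DecidableEq V] (hx : x ∈ A)
    (hs : ∀ z ∉ A, s z = 0) (hnonneg : ∀ z, 0 ≤ s z) (y : V) :
    W.killedIterate (A : Set V) 0 x y
        + ∑' z, W.killedTransition (A : Set V) x z * ENNReal.ofReal (s z)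
      = ENNReal.ofReal ((if x = y then 1 else 0) + (s x + W.muLaplacian s x / W.mass x)) := by
  rw [W.tsum_killedTransition_mul_ofReal hx hs hnonneg, ENNReal.ofReal_add (by positivity)
    (W.add_muLaplacian_div_mass_nonneg hs hnonneg)]
  congr 1
  split_ifs with hxy
  · rw [← hxy, W.killedIterate_zero_self (Finset.mem_coe.2 hx), ENNReal.ofReal_one]
  · rw [W.killedIterate_zero_of_ne _ hxy, ENNReal.ofReal_zero]

end FirstStep

theorem greenFunction_ne_top (A : Finset V) (x y : V) : W.greenFunction (A : Set V) x y ≠ ∞ := by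
  classical
  obtain ⟨s, hs, hlap⟩ := W.exists_muLaplacian_eq A fun x => if x = y then - W.mass x else 0
  have hlap_nonpos : ∀ x ∈ A, W.muLaplacian s x ≤ 0 := fun x hx => by
    rw [hlap x hx]
    split_ifs
    exacts [neg_nonpos.2 (W.mass_nonneg x), le_rfl]
  have hnonneg : ∀ z, 0 ≤ s z := fun z => by
    by_cases hz : z ∈ A
    · exact W.nonneg_of_muLaplacian_nonpos hlap_nonpos (fun x _ y _ hy => (hs y hy).ge) z hz
    · exact (hs z hz).ge
  refine ne_top_of_le_ne_top ENNReal.ofReal_ne_top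
    (W.greenFunction_le (s := fun z => ENNReal.ofReal (s z)) (fun x hx => ?_) x)
  rw [W.killedIterate_zero_add_tsum_ofReal hx hs hnonneg, hlap x hx]
  refine (congrArg ENNReal.ofReal ?_).le
  have hmass := (W.mass_pos x).ne'
  split_ifs
  · rw [neg_div, div_self hmass]
    ring
  · simp

theorem greenKernel_eq_ofReal (A : Finset V) (x y : V) :
    W.greenKernel (A : Set V) x y = ENNReal.ofReal (W.green A x y) :=
  (ENNReal.ofReal_toReal (ENNReal.div_ne_top (W.greenFunction_ne_top A x y)
    (ENNReal.coe_ne_zero.2 (W.vertexMeasure_pos y).ne'))).symm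

theorem greenFunction_eq_ofReal (A : Finset V) (x y : V) :
    W.greenFunction (A : Set V) x y = ENNReal.ofReal (W.mass y * W.green A x y) := by
  rw [ENNReal.ofReal_mul (W.mass_nonneg y), ← greenKernel_eq_ofReal, greenKernel, mass,
    ENNReal.ofReal_coe_nnreal, ENNReal.mul_div_cancel (ENNReal.coe_ne_zero.2
      (W.vertexMeasure_pos y).ne') ENNReal.coe_ne_top]

theorem muLaplacian_green_left [DecidableEq V] {A : Finset V} {x : V} (hx : x ∈ A) (y : V) :
    W.muLaplacian (fun z => W.green A z y) x = if x = y then -1 else 0 := by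
  set s : V → ℝ := W.mass y • fun z => W.green A z y with hs
  have hsupp : ∀ z ∉ A, s z = 0 := fun z hz =>
    (congrArg (W.mass y * ·) (W.green_of_notMem_left hz y)).trans (mul_zero _)
  have hnonneg : ∀ z, 0 ≤ s z := fun z => mul_nonneg (W.mass_nonneg y) (W.green_nonneg A z y)
  have hgreen : ∀ z, W.greenFunction (A : Set V) z y = ENNReal.ofReal (s z) := fun z =>
    W.greenFunction_eq_ofReal A z y
  have hstep : s x = (if x = y then 1 else 0) + (s x + W.muLaplacian s x / W.mass x) := by
    rw [← ENNReal.ofReal_eq_ofReal_iff (hnonneg x) (add_nonneg (by positivity)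
      (W.add_muLaplacian_div_mass_nonneg hsupp hnonneg)),
      ← W.killedIterate_zero_add_tsum_ofReal hx hsupp hnonneg]
    simp_rw [← hgreen]
    exact W.greenFunction_eq _ x y
  have hlap : W.muLaplacian s x
      = W.mass y * W.muLaplacian (fun z => W.green A z y) x := by rw [hs, map_smul]; rfl
  have hmass := (W.mass_pos y).ne'
  split_ifs at hstep ⊢ with hxy
  · rw [hlap, hxy, mul_div_cancel_left₀ _ hmass] at hstep
    rw [hxy]
    linarith
  · have hzero : W.muLaplacian s x / W.mass x = 0 := by linarith
    rw [hlap, div_eq_zero_iff, mul_eq_zero] at hzero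
    exact (hzero.resolve_right (W.mass_pos x).ne').resolve_left hmass

theorem sum_mul_muLaplacian_green_left {A : Finset V} (f : V → ℝ) {y : V} (hy : y ∈ A) :
    ∑ z ∈ A, f z * W.muLaplacian (fun w => W.green A w y) z = - f y := by
  classical
  rw [Finset.sum_eq_single_of_mem y hy fun z hz hzy => by
    rw [W.muLaplacian_green_left hz, if_neg hzy, mul_zero], W.muLaplacian_green_left hy,
    if_pos rfl, mul_neg_one]

theorem green_symm (A : Finset V) (x y : V) : W.green A x y = W.green A y x := by
  by_cases hx : x ∈ A
  · by_cases hy : y ∈ A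
    · have hparts := W.sum_mul_muLaplacian_comm (S := A) (f := fun z => W.green A z x)
        (g := fun z => W.green A z y) (fun z hz => W.green_of_notMem_left hz x)
        fun z hz => W.green_of_notMem_left hz y
      rw [W.sum_mul_muLaplacian_green_left _ hx, W.sum_mul_muLaplacian_green_left _ hy] at hparts
      exact (neg_inj.1 hparts).symm
    · rw [W.green_of_notMem_right x hy, W.green_of_notMem_left hy]
  · rw [W.green_of_notMem_left hx, W.green_of_notMem_right y hx]

theorem muLaplacian_green [DecidableEq V] {A : Finset V} (x : V) {y : V} (hy : y ∈ A) :
    W.muLaplacian (W.green A x) y = if y = x then -1 else 0 := by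
  rw [← W.muLaplacian_green_left hy x]
  exact congrArg (W.muLaplacian · y) (funext (W.green_symm A x))

theorem muLaplacian_green_of_ne {A : Finset V} {x y : V} (hy : y ∈ A) (h : y ≠ x) :
    W.muLaplacian (W.green A x) y = 0 := by
  classical
  rw [W.muLaplacian_green x hy, if_neg h]

theorem muLaplacian_green_nonpos {A : Finset V} (x : V) {y : V} (hy : y ∈ A) :
    W.muLaplacian (W.green A x) y ≤ 0 := by
  classical
  rw [W.muLaplacian_green x hy]
  split_ifs <;> norm_num

theorem sum_mul_muLaplacian_green {A : Finset V} (f : V → ℝ) {x : V} (hx : x ∈ A) :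
    ∑ z ∈ A, f z * W.muLaplacian (W.green A x) z = - f x := by
  simp_rw [← W.sum_mul_muLaplacian_green_left f hx, fun z => W.green_symm A z x]

theorem sum_green_mul_muLaplacian {A : Finset V} {f : V → ℝ} (hf : ∀ z ∉ A, f z = 0) {x : V}
    (hx : x ∈ A) : ∑ z ∈ A, W.green A x z * W.muLaplacian f z = - f x := by
  rw [W.sum_mul_muLaplacian_comm (fun z hz => W.green_of_notMem_right x hz) hf,
    W.sum_mul_muLaplacian_green f hx]

/-- The Green potential `x ↦ ∑_{z ∈ A} g^A(x,z) k(z)` of the charge `k`. The sum is against the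
counting measure, so that it solves the Poisson equation of `μΔ` rather than of `Δ`. -/
noncomputable def greenPotential (A : Finset V) (k : V → ℝ) (x : V) : ℝ :=
  ∑ z ∈ A, W.green A x z * k z

theorem muLaplacian_greenPotential {A : Finset V} (k : V → ℝ) {x : V} (hx : x ∈ A) :
    W.muLaplacian (W.greenPotential A k) x = - k x := by
  classical
  have hsum : W.greenPotential A k = ∑ z ∈ A, k z • fun y => W.green A y z := by
    ext y
    simp only [greenPotential, Finset.sum_apply, Pi.smul_apply, smul_eq_mul, mul_comm]
  rw [hsum, map_sum, Finset.sum_apply]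
  simp only [map_smul, Pi.smul_apply, W.muLaplacian_green_left hx, smul_eq_mul, mul_ite,
    mul_neg_one, mul_zero, Finset.sum_ite_eq, hx, if_true]

theorem green_mono {A B : Finset V} (h : A ⊆ B) (x y : V) : W.green A x y ≤ W.green B x y := by
  classical
  by_cases hy : y ∈ A
  · refine W.le_of_muLaplacian_le (A := A) (u := W.green A x) (v := W.green B x) (fun z hz => ?_)
      (fun z _ w _ hw => ?_) y hy
    · rw [W.muLaplacian_green x hz, W.muLaplacian_green x (h hz)]
    · rw [W.green_of_notMem_right x hw]
      exact W.green_nonneg B x w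
  · rw [W.green_of_notMem_right x hy]
    exact W.green_nonneg B x y

theorem sum_muLaplacian_green_le_one {A S : Finset V} (hdisj : Disjoint S A) (x : V) :
    ∑ w ∈ S, W.muLaplacian (W.green A x) w ≤ 1 := by
  classical
  have htotal := W.sum_muLaplacian_nonpos (S := S ∪ A) (f := W.green A x)
    (fun y hy => W.green_of_notMem_right x fun hyA => hy (Finset.mem_union_right S hyA))
    (W.green_nonneg A x)
  have hsource : -1 ≤ ∑ w ∈ A, W.muLaplacian (W.green A x) w := by
    rw [Finset.sum_congr rfl fun w hw => W.muLaplacian_green x hw, Finset.sum_ite_eq']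
    split_ifs <;> norm_num
  rw [Finset.sum_union hdisj] at htotal
  linarith

end GreenKernel

section Balls

variable {V : Type*} (W : WeightedGraph V)

theorem exists_geodesic (a b : V) : ∃ γ : ℕ → V, γ 0 = a ∧ γ (W.graph.dist a b) = b ∧
    (∀ i < W.graph.dist a b, W.graph.Adj (γ i) (γ (i + 1))) ∧
    ∀ i j, i ≤ j → j ≤ W.graph.dist a b → W.graph.dist (γ i) (γ j) = j - i := by
  obtain ⟨w, hw⟩ := W.connected.exists_walk_length_eq_dist a b
  refine ⟨w.getVert, w.getVert_zero, hw ▸ w.getVert_length,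
    fun i hi => w.adj_getVert_succ (hw ▸ hi), fun i j hij hj => ?_⟩
  have h := SimpleGraph.length_eq_dist_of_subwalk hw
    (((w.drop i).isSubwalk_take (j - i)).trans (w.isSubwalk_drop i))
  rw [SimpleGraph.Walk.take_length, SimpleGraph.Walk.drop_length, SimpleGraph.Walk.drop_getVert,
    Nat.add_sub_cancel' hij] at h
  omega

theorem cast_dist_triangle (x y z : V) :
    (W.graph.dist x z : ℝ) ≤ W.graph.dist x y + W.graph.dist y z := by
  exact_mod_cast W.connected.dist_triangle

theorem cast_dist_comm (x y : V) : (W.graph.dist x y : ℝ) = W.graph.dist y x :=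
  congrArg Nat.cast SimpleGraph.dist_comm

theorem dist_le_add_one_of_adj {x y z : V} (h : W.graph.Adj y z) :
    W.graph.dist x z ≤ W.graph.dist x y + 1 :=
  SimpleGraph.dist_eq_one_iff_adj.2 h ▸ W.connected.dist_triangle

theorem cast_dist_le_add_one_of_adj {x y z : V} (h : W.graph.Adj y z) :
    (W.graph.dist x z : ℝ) ≤ W.graph.dist x y + 1 := by
  exact_mod_cast W.dist_le_add_one_of_adj h

theorem cast_dist_lt_two_mul_of_adj {x y z : V} {R : ℝ} (hR : 1 / 2 < R)
    (hz : (W.graph.dist x z : ℝ) < R) (hzy : W.graph.Adj z y) : (W.graph.dist x y : ℝ) < 2 * R := by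
  have hy := W.cast_dist_le_add_one_of_adj (x := x) hzy
  rcases lt_or_ge R 1 with hR1 | hR1
  · have hzx : W.graph.dist x z = 0 := Nat.lt_one_iff.1 (by exact_mod_cast hz.trans hR1)
    rw [hzx, Nat.cast_zero] at hy
    linarith
  · linarith

theorem eq_of_cast_dist_lt_one {x y : V} (h : (W.graph.dist x y : ℝ) < 1) : x = y :=
  W.connected.dist_eq_zero_iff.1 (Nat.lt_one_iff.1 (by exact_mod_cast h))

/-- The points on the geodesics from `a` to `b`. -/
def geodesicInterval (a b : V) : Set V :=
  {z | W.graph.dist a z + W.graph.dist z b = W.graph.dist a b}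

theorem geodesicInterval_comm (a b : V) : W.geodesicInterval a b = W.geodesicInterval b a := by
  ext z
  change W.graph.dist a z + W.graph.dist z b = W.graph.dist a b ↔
    W.graph.dist b z + W.graph.dist z a = W.graph.dist b a
  rw [SimpleGraph.dist_comm (u := b) (v := z), SimpleGraph.dist_comm (u := z) (v := a),
    SimpleGraph.dist_comm (u := b) (v := a), add_comm]

theorem geodesic_chain {P : V → ℝ → Prop} {q : ℝ} (hq : 0 ≤ q) {a b : V} {k n : ℕ}
    (hstep : ∀ y ∈ W.geodesicInterval a b, ∀ z ∈ W.geodesicInterval a b, W.graph.dist y z ≤ k →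
      ∀ α, 0 ≤ α → P y α → P z (q * α))
    (hab : W.graph.dist a b ≤ n * k) {α : ℝ} (hα : 0 ≤ α) (ha : P a α) : P b (q ^ n * α) := by
  obtain ⟨γ, hγ_zero, hγ_dist, -, hdist⟩ := W.exists_geodesic a b
  have hγ : ∀ j ≤ W.graph.dist a b, γ j ∈ W.geodesicInterval a b := fun j hj => by
    have hleft := hdist 0 j (Nat.zero_le _) hj
    have hright := hdist j _ hj le_rfl
    rw [hγ_zero] at hleft
    rw [hγ_dist] at hright
    change W.graph.dist a (γ j) + W.graph.dist (γ j) b = W.graph.dist a b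
    omega
  have hchain : ∀ m, P (γ (min (m * k) (W.graph.dist a b))) (q ^ m * α) := fun m => by
    induction m with
    | zero => simpa [hγ_zero] using ha
    | succ m ih =>
      have hmk : (m + 1) * k = m * k + k := Nat.succ_mul m k
      rw [pow_succ', mul_assoc]
      refine hstep _ (hγ _ (min_le_right _ _)) _ (hγ _ (min_le_right _ _)) ?_ _ (by positivity) ih
      rw [hdist _ _ (by omega) (min_le_right _ _)]
      omega
  simpa [min_eq_right hab, hγ_dist] using hchain n

variable [W.graph.LocallyFinite]

theorem finite_setOf_dist_le (x : V) (n : ℕ) : {y | W.graph.dist x y ≤ n}.Finite := by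
  induction n with
  | zero =>
    refine (Set.finite_singleton x).subset fun y hy => ?_
    exact (W.connected.dist_eq_zero_iff.1 (Nat.le_zero.1 hy)).symm
  | succ n ih =>
    refine (ih.union (ih.biUnion fun z _ => (W.graph.neighborFinset z).finite_toSet)).subset
      fun y hy => ?_
    obtain ⟨γ, hγ_zero, hγ_dist, hadj, hdist⟩ := W.exists_geodesic x y
    rcases Nat.le_succ_iff.1 hy with h | h
    · exact Or.inl h
    · refine Or.inr (Set.mem_biUnion (x := γ n) ?_ ?_)
      · have := hdist 0 n (Nat.zero_le _) (by omega)
        rw [hγ_zero] at this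
        exact this.le
      · have := hadj n (by omega)
        rw [← Nat.succ_eq_add_one, ← h, hγ_dist] at this
        exact (W.graph.mem_neighborFinset _ _).2 this

theorem finite_ball (x : V) (R : ℝ) : (W.ball x R).Finite :=
  (W.finite_setOf_dist_le x ⌈R⌉₊).subset fun _ hy =>
    (Nat.cast_lt.1 (lt_of_lt_of_le hy (Nat.le_ceil R))).le

/-- The ball `B(x,R)` as a finite set. -/
noncomputable def ballFinset (x : V) (R : ℝ) : Finset V := (W.finite_ball x R).toFinset

variable {W} in
theorem mem_ballFinset {x y : V} {R : ℝ} :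
    y ∈ W.ballFinset x R ↔ (W.graph.dist x y : ℝ) < R := by
  simp [ballFinset, ball]

theorem coe_ballFinset (x : V) (R : ℝ) : (W.ballFinset x R : Set V) = W.ball x R :=
  Set.Finite.coe_toFinset _

theorem self_mem_ballFinset (x : V) {R : ℝ} (hR : 0 < R) : x ∈ W.ballFinset x R := by
  rw [mem_ballFinset, SimpleGraph.dist_self, Nat.cast_zero]
  exact hR

theorem ballFinset_subset {x y : V} {r R : ℝ} (h : W.graph.dist x y + r ≤ R) :
    W.ballFinset y r ⊆ W.ballFinset x R := fun z hz => by
  rw [mem_ballFinset] at hz ⊢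
  linarith [W.cast_dist_triangle x y z]

theorem ballFinset_mono (x : V) {r R : ℝ} (h : r ≤ R) : W.ballFinset x r ⊆ W.ballFinset x R :=
  W.ballFinset_subset (by simpa using h)

theorem ballFinset_eq_singleton (x : V) {r : ℝ} (hr : 0 < r) (hr1 : r ≤ 1) :
    W.ballFinset x r = {x} := by
  refine Finset.eq_singleton_iff_unique_mem.2 ⟨W.self_mem_ballFinset x hr, fun y hy => ?_⟩
  exact (W.eq_of_cast_dist_lt_one ((mem_ballFinset.1 hy).trans_le hr1)).symm

theorem exists_dist_eq [Infinite V] (x : V) (n : ℕ) : ∃ y, W.graph.dist x y = n := by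
  obtain ⟨y, hy⟩ := (W.finite_setOf_dist_le x n).infinite_compl.nonempty
  obtain ⟨γ, hγ_zero, -, -, hdist⟩ := W.exists_geodesic x y
  have h := hdist 0 n (Nat.zero_le _) (not_le.1 (Set.mem_compl_iff _ _ |>.1 hy)).le
  rw [hγ_zero] at h
  exact ⟨γ n, h⟩

/-- The volume `V(x,R)` as a real number. -/
noncomputable def ballVolume (x : V) (R : ℝ) : ℝ := ∑ y ∈ W.ballFinset x R, W.mass y

/-- The Green kernel `g^{B(x,R)}(x,y)` of a ball with pole at its centre, as a real number. -/
noncomputable def ballGreen (x : V) (R : ℝ) (y : V) : ℝ := W.green (W.ballFinset x R) x y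

/-- The mean exit time `E(x,R)` as a real number, in terms of the Green kernel; see
`meanExit_eq_ofReal`. -/
noncomputable def ballExitTime (x : V) (R : ℝ) : ℝ :=
  ∑ y ∈ W.ballFinset x R, W.ballGreen x R y * W.mass y

/-- The order of magnitude `E(x,2R) / V(x,R)` of the Green kernel in condition `(g)`. -/
noncomputable def greenScale (x : V) (R : ℝ) : ℝ := W.ballExitTime x (2 * R) / W.ballVolume x R

theorem ballGreen_nonneg (x : V) (R : ℝ) (y : V) : 0 ≤ W.ballGreen x R y := W.green_nonneg _ _ _

theorem ballGreen_of_le_dist {x y : V} {R : ℝ} (h : R ≤ W.graph.dist x y) :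
    W.ballGreen x R y = 0 :=
  W.green_of_notMem_right x (mt mem_ballFinset.1 h.not_gt)

theorem vol_eq_ofReal (x : V) (R : ℝ) : W.vol x R = ENNReal.ofReal (W.ballVolume x R) := by
  rw [vol, setMeasure, ← coe_ballFinset, ballVolume,
    ENNReal.ofReal_sum_of_nonneg fun y _ => W.mass_nonneg y,
    Finset.tsum_subtype' (W.ballFinset x R) fun y => (W.vertexMeasure y : ℝ≥0∞)]
  exact Finset.sum_congr rfl fun y _ => ENNReal.ofReal_coe_nnreal.symm

theorem ballVolume_nonneg (x : V) (R : ℝ) : 0 ≤ W.ballVolume x R :=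
  Finset.sum_nonneg fun y _ => W.mass_nonneg y

theorem ballVolume_le_of_subset {x y : V} {r R : ℝ} (h : W.ballFinset x r ⊆ W.ballFinset y R) :
    W.ballVolume x r ≤ W.ballVolume y R :=
  Finset.sum_le_sum_of_subset_of_nonneg h fun _ _ _ => W.mass_nonneg _

theorem ballExitTime_nonneg (x : V) (R : ℝ) : 0 ≤ W.ballExitTime x R :=
  Finset.sum_nonneg fun y _ => mul_nonneg (W.ballGreen_nonneg x R y) (W.mass_nonneg y)

variable {W} in
theorem mul_ballVolume_le_ballExitTime {x : V} {m R : ℝ} (hR : 0 < R)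
    (h : ∀ y, (W.graph.dist x y : ℝ) < R → m ≤ W.ballGreen x (2 * R) y) :
    m * W.ballVolume x R ≤ W.ballExitTime x (2 * R) := by
  rw [ballVolume, Finset.mul_sum]
  exact (Finset.sum_le_sum fun y hy =>
      mul_le_mul_of_nonneg_right (h y (mem_ballFinset.1 hy)) (W.mass_nonneg y)).trans
    (Finset.sum_le_sum_of_subset_of_nonneg (W.ballFinset_mono x (by linarith)) fun y _ _ =>
      mul_nonneg (W.ballGreen_nonneg _ _ _) (W.mass_nonneg y))

variable [Infinite V]

theorem ballVolume_pos (x : V) {R : ℝ} (hR : 0 < R) : 0 < W.ballVolume x R :=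
  Finset.sum_pos (fun y _ => W.mass_pos y) ⟨x, W.self_mem_ballFinset x hR⟩

theorem ballGreen_mono (x : V) {r R : ℝ} (h : r ≤ R) (y : V) :
    W.ballGreen x r y ≤ W.ballGreen x R y :=
  W.green_mono (W.ballFinset_mono x h) x y

theorem ballExitTime_mono (x : V) {r R : ℝ} (h : r ≤ R) :
    W.ballExitTime x r ≤ W.ballExitTime x R :=
  (Finset.sum_le_sum fun y _ =>
      mul_le_mul_of_nonneg_right (W.ballGreen_mono x h y) (W.mass_nonneg y)).trans
    (Finset.sum_le_sum_of_subset_of_nonneg (W.ballFinset_mono x h) fun y _ _ =>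
      mul_nonneg (W.ballGreen_nonneg x R y) (W.mass_nonneg y))

theorem one_le_ballGreen_self_mul_mass (x : V) {R : ℝ} (hR : 0 < R) :
    1 ≤ W.ballGreen x R x * W.mass x := by
  classical
  have h := W.muLaplacian_green x (W.self_mem_ballFinset x hR)
  rw [if_pos rfl, muLaplacian_eq_sum_sub] at h
  have hnonneg : 0 ≤ ∑ y ∈ W.graph.neighborFinset x,
      W.conductance x y * W.green (W.ballFinset x R) x y :=
    Finset.sum_nonneg fun y _ => mul_nonneg (W.conductance_nonneg x y) (W.green_nonneg _ _ _)
  rw [ballGreen, mul_comm]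
  linarith

theorem ballExitTime_pos (x : V) {R : ℝ} (hR : 0 < R) : 0 < W.ballExitTime x R :=
  calc 0 < W.ballGreen x R x * W.mass x :=
        zero_lt_one.trans_le (W.one_le_ballGreen_self_mul_mass x hR)
    _ ≤ W.ballExitTime x R := Finset.single_le_sum (f := fun y => W.ballGreen x R y * W.mass y)
        (fun y _ => mul_nonneg (W.ballGreen_nonneg x R y) (W.mass_nonneg y))
        (W.self_mem_ballFinset x hR)

theorem greenScale_pos (x : V) {R : ℝ} (hR : 0 < R) : 0 < W.greenScale x R :=
  div_pos (W.ballExitTime_pos x (by positivity)) (W.ballVolume_pos x hR)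

theorem greenScale_mul_ballVolume (x : V) {R : ℝ} (hR : 0 < R) :
    W.greenScale x R * W.ballVolume x R = W.ballExitTime x (2 * R) :=
  div_mul_cancel₀ _ (W.ballVolume_pos x hR).ne'

/-- Condition `(g)` with constants `C` and `c`, in terms of real numbers. The normalization
`c ≤ 1 ≤ C` costs nothing. -/
structure GreenBounds (C c : ℝ) : Prop where
  one_le : 1 ≤ C
  pos : 0 < c
  le_one : c ≤ 1
  upper : ∀ (x : V) (R : ℝ), 0 < R → ∀ y, R ≤ W.graph.dist x y →
    W.ballGreen x (2 * R) y ≤ C * W.greenScale x R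
  lower : ∀ (x : V) (R : ℝ), 0 < R → ∀ y, (W.graph.dist x y : ℝ) < R →
    c * W.greenScale x R ≤ W.ballGreen x (2 * R) y

section RandomWalk

variable [Countable V] [MeasurableSpace V] [DiscreteMeasurableSpace V]

theorem meanExit_eq_ofReal (x : V) (R : ℝ) :
    W.meanExit x R = ENNReal.ofReal (W.ballExitTime x R) := by
  rw [meanExit, meanExitFrom_eq_tsum, ← coe_ballFinset, ballExitTime,
    ENNReal.ofReal_sum_of_nonneg fun y _ =>
      mul_nonneg (W.ballGreen_nonneg x R y) (W.mass_nonneg y),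
    tsum_eq_sum fun y hy => W.greenFunction_of_notMem_right x (mt Finset.mem_coe.1 hy)]
  exact Finset.sum_congr rfl fun y _ => by rw [W.greenFunction_eq_ofReal, mul_comm, ballGreen]

theorem meanExit_div_vol (x : V) {R : ℝ} (hR : 0 < R) :
    W.meanExit x (2 * R) / W.vol x R = ENNReal.ofReal (W.greenScale x R) := by
  rw [meanExit_eq_ofReal, vol_eq_ofReal, greenScale,
    ENNReal.ofReal_div_of_pos (W.ballVolume_pos x hR)]

theorem iSup_greenKernel_le_iff (C : ℝ≥0) (x : V) {R : ℝ} (hR : 0 < R) :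
    ((⨆ y ∈ (W.ball x R)ᶜ, W.greenKernel (W.ball x (2 * R)) x y)
      ≤ C * (W.meanExit x (2 * R) / W.vol x R)) ↔
    ∀ y, R ≤ W.graph.dist x y → W.ballGreen x (2 * R) y ≤ C * W.greenScale x R := by
  rw [iSup₂_le_iff, W.meanExit_div_vol x hR, ← coe_ballFinset W x (2 * R)]
  refine forall_congr' fun y => ?_
  rw [greenKernel_eq_ofReal, ← ENNReal.ofReal_coe_nnreal,
    ← ENNReal.ofReal_mul (NNReal.coe_nonneg C), ENNReal.ofReal_le_ofReal_iff
    (mul_nonneg (NNReal.coe_nonneg C) (W.greenScale_pos x hR).le)]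
  simp [ball, ballGreen]

theorem le_iInf_greenKernel_iff (c : ℝ≥0) (x : V) {R : ℝ} (hR : 0 < R) :
    (c * (W.meanExit x (2 * R) / W.vol x R)
      ≤ ⨅ y ∈ W.ball x R, W.greenKernel (W.ball x (2 * R)) x y) ↔
    ∀ y, (W.graph.dist x y : ℝ) < R → c * W.greenScale x R ≤ W.ballGreen x (2 * R) y := by
  rw [le_iInf₂_iff, W.meanExit_div_vol x hR, ← coe_ballFinset W x (2 * R)]
  refine forall_congr' fun y => ?_
  rw [greenKernel_eq_ofReal, ← ENNReal.ofReal_coe_nnreal,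
    ← ENNReal.ofReal_mul (NNReal.coe_nonneg c),
    ENNReal.ofReal_le_ofReal_iff (W.green_nonneg _ _ _)]
  simp [ball, ballGreen]

theorem greenKernelBounds_iff : W.GreenKernelBounds ↔ ∃ C c, W.GreenBounds C c := by
  constructor
  · rintro ⟨C, c, -, hc, h⟩
    refine ⟨max C 1, min c 1, le_max_right _ _, lt_min hc one_pos, min_le_right _ _,
      fun x R hR y hy => ?_, fun x R hR y hy => ?_⟩
    · exact ((W.iSup_greenKernel_le_iff C x hR).1 (h x R hR).1 y hy).trans
        (mul_le_mul_of_nonneg_right (le_max_left _ _) (W.greenScale_pos x hR).le)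
    · exact (mul_le_mul_of_nonneg_right (min_le_left _ _) (W.greenScale_pos x hR).le).trans
        ((W.le_iInf_greenKernel_iff c x hR).1 (h x R hR).2 y hy)
  · rintro ⟨C, c, h⟩
    have hC : 0 < C := zero_lt_one.trans_le h.one_le
    exact ⟨⟨C, hC.le⟩, ⟨c, h.pos.le⟩, hC, h.pos, fun x R hR =>
      ⟨(W.iSup_greenKernel_le_iff _ x hR).2 (h.upper x R hR),
        (W.le_iInf_greenKernel_iff _ x hR).2 (h.lower x R hR)⟩⟩

end RandomWalk

end Balls

section Ellipticity

variable {V : Type*}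

/-- Condition `(p₀)` with constant `p`, in terms of real numbers. The normalization `p ≤ 1` costs
nothing. -/
structure Elliptic (W : WeightedGraph V) (p : ℝ) : Prop where
  pos : 0 < p
  le_one : p ≤ 1
  mul_mass_le : ∀ x y, W.graph.Adj x y → p * W.mass x ≤ W.conductance x y

variable {W : WeightedGraph V} [Infinite V] {p : ℝ}

theorem ControlledWeights.exists_elliptic (h : W.ControlledWeights) : ∃ p, W.Elliptic p := by
  obtain ⟨p, hp, hP⟩ := h
  refine ⟨min p 1, lt_min hp one_pos, min_le_right _ _, fun x y hxy => ?_⟩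
  have htrans : (p : ℝ) ≤ W.conductance x y / W.mass x :=
    W.coe_transition x y ▸ NNReal.coe_le_coe.2 (hP x y hxy)
  rw [le_div_iff₀ (W.mass_pos x)] at htrans
  exact (mul_le_mul_of_nonneg_right (min_le_left _ _) (W.mass_nonneg x)).trans htrans

theorem Elliptic.finite_neighborSet (hp : W.Elliptic p) (x : V) :
    (W.graph.neighborSet x).Finite := by
  have hpos : 0 < p * W.mass x := mul_pos hp.pos (W.mass_pos x)
  have hsmall : ∀ᶠ y in Filter.cofinite, W.weight x y < (p * W.mass x).toNNReal :=
    (NNReal.tendsto_cofinite_zero_of_summable (W.weight_summable x)).eventually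
      (gt_mem_nhds (Real.toNNReal_pos.2 hpos))
  exact (Filter.eventually_cofinite.1 hsmall).subset fun y hy =>
    not_lt.2 (Real.toNNReal_le_iff_le_coe.2 (hp.mul_mass_le x y hy))

theorem Elliptic.mul_le_of_adj [W.graph.LocallyFinite] (hp : W.Elliptic p) {u : V → ℝ} {x y : V}
    (hu : W.muLaplacian u x ≤ 0) (hnonneg : ∀ z, W.graph.Adj x z → 0 ≤ u z)
    (hxy : W.graph.Adj x y) : p * u y ≤ u x := by
  refine le_of_mul_le_mul_left ?_ (W.mass_pos x)
  rw [muLaplacian_eq_sum_sub] at hu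
  calc W.mass x * (p * u y) = p * W.mass x * u y := by ring
    _ ≤ W.conductance x y * u y :=
        mul_le_mul_of_nonneg_right (hp.mul_mass_le x y hxy) (hnonneg y hxy)
    _ ≤ ∑ z ∈ W.graph.neighborFinset x, W.conductance x z * u z :=
        Finset.single_le_sum (f := fun z => W.conductance x z * u z)
          (fun z hz => mul_nonneg (W.conductance_nonneg x z)
            (hnonneg z ((W.graph.mem_neighborFinset x z).1 hz)))
          ((W.graph.mem_neighborFinset x y).2 hxy)
    _ ≤ W.mass x * u x := sub_nonpos.1 hu

theorem Elliptic.mul_le_of_dist_le_one [W.graph.LocallyFinite] (hp : W.Elliptic p) {u : V → ℝ}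
    {x y : V} (hu : W.muLaplacian u x ≤ 0) (hx : 0 ≤ u x) (hnonneg : ∀ z, W.graph.Adj x z → 0 ≤ u z)
    (hxy : W.graph.dist y x ≤ 1) : p * u y ≤ u x := by
  rcases Nat.le_one_iff_eq_zero_or_eq_one.1 hxy with hxy | hxy
  · rw [W.connected.dist_eq_zero_iff.1 hxy]
    exact mul_le_of_le_one_left hx hp.le_one
  · exact hp.mul_le_of_adj hu hnonneg (SimpleGraph.dist_eq_one_iff_adj.1 hxy).symm

end Ellipticity

section Doubling

variable {V : Type*} (W : WeightedGraph V) [W.graph.LocallyFinite]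

/-- Volume doubling with constant `D`, in terms of real numbers. The normalization `1 ≤ D` costs
nothing. -/
structure Doubling (D : ℝ) : Prop where
  one_le : 1 ≤ D
  le_mul : ∀ x R, 0 < R → W.ballVolume x (2 * R) ≤ D * W.ballVolume x R

variable {W}

theorem VolumeDoubling.exists_doubling (h : W.VolumeDoubling) : ∃ D, W.Doubling D := by
  obtain ⟨D, -, hD⟩ := h
  refine ⟨max D 1, le_max_right _ _, fun x R hR => ?_⟩
  have hvol := hD x R hR
  rw [vol_eq_ofReal, vol_eq_ofReal, ← ENNReal.ofReal_coe_nnreal, ← ENNReal.ofReal_mul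
    (NNReal.coe_nonneg D), ENNReal.ofReal_le_ofReal_iff
    (mul_nonneg (NNReal.coe_nonneg D) (W.ballVolume_nonneg x R))] at hvol
  exact hvol.trans (mul_le_mul_of_nonneg_right (le_max_left _ _) (W.ballVolume_nonneg x R))

theorem Doubling.le_pow_mul {D : ℝ} (h : W.Doubling D) (x : V) {R : ℝ} (hR : 0 < R) (k : ℕ) :
    W.ballVolume x (2 ^ k * R) ≤ D ^ k * W.ballVolume x R := by
  induction k with
  | zero => simp
  | succ k ih =>
    calc W.ballVolume x (2 ^ (k + 1) * R) = W.ballVolume x (2 * (2 ^ k * R)) := by ring_nf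
      _ ≤ D * W.ballVolume x (2 ^ k * R) := h.le_mul x (2 ^ k * R) (by positivity)
      _ ≤ D * (D ^ k * W.ballVolume x R) :=
          mul_le_mul_of_nonneg_left ih (zero_le_one.trans h.one_le)
      _ = D ^ (k + 1) * W.ballVolume x R := by ring

end Doubling

section Harmonic

variable {V : Type*} (W : WeightedGraph V) [W.graph.LocallyFinite] [Infinite V]

theorem hasSum_transition_mul (u : V → ℝ) (x : V) :
    HasSum (fun y => (W.transition x y : ℝ) * u y) (u x + W.muLaplacian u x / W.mass x) := by
  have hsum : u x + W.muLaplacian u x / W.mass x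
      = ∑ y ∈ W.graph.neighborFinset x, (W.transition x y : ℝ) * u y := by
    have hmass := (W.mass_pos x).ne'
    simp only [muLaplacian_eq_sum_sub, coe_transition, sub_div, mul_div_cancel_left₀ _ hmass,
      Finset.sum_div, div_mul_eq_mul_div]
    ring
  rw [hsum]
  refine hasSum_sum_of_ne_finset_zero fun y hy => ?_
  rw [coe_transition, W.conductance_eq_zero (mt (W.graph.mem_neighborFinset x y).2 hy), zero_div,
    zero_mul]

theorem harmonicOn_iff {u : V → ℝ} {A : Set V} :
    W.HarmonicOn u A ↔ ∀ x ∈ A, W.muLaplacian u x = 0 := by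
  refine forall₂_congr fun x _ => ⟨fun h => ?_, fun h => ?_⟩
  · simpa [(W.mass_pos x).ne'] using h.unique (W.hasSum_transition_mul u x)
  · simpa [h] using W.hasSum_transition_mul u x

theorem laplacian_mul_mass (f : V → ℝ) (x : V) :
    W.laplacian f x * W.mass x = W.muLaplacian f x := by
  rw [laplacian, markovOp, (W.hasSum_transition_mul f x).tsum_eq, add_sub_cancel_left,
    div_mul_cancel₀ _ (W.mass_pos x).ne']

end Harmonic

section Resistance

variable {V : Type*} (W : WeightedGraph V)

theorem min_green_of_notMem {A : Finset V} (x : V) {M : ℝ} (hM : 0 ≤ M) {z : V} (hz : z ∉ A) :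
    min (W.green A x z) M = 0 := by
  rw [W.green_of_notMem_right x hz, min_eq_left hM]

variable [W.graph.LocallyFinite]

/-- The energy `(-Δf, f)` of a function `f` supported in the finite set `S`. -/
noncomputable def energy (S : Finset V) (f : V → ℝ) : ℝ := - ∑ x ∈ S, f x * W.muLaplacian f x

theorem energy_smul (S : Finset V) (a : ℝ) (f : V → ℝ) :
    W.energy S (a • f) = a ^ 2 * W.energy S f := by
  simp only [energy, map_smul, Pi.smul_apply, smul_eq_mul, mul_neg, Finset.mul_sum]
  exact congrArg Neg.neg (Finset.sum_congr rfl fun x _ => by ring)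

theorem energy_sub {S : Finset V} {f w : V → ℝ} (hf : ∀ z ∉ S, f z = 0) (hw : ∀ z ∉ S, w z = 0) :
    W.energy S (f - w)
      = W.energy S f + 2 * ∑ x ∈ S, f x * W.muLaplacian w x + W.energy S w := by
  simp only [energy, map_sub, Pi.sub_apply, mul_sub, sub_mul, Finset.sum_sub_distrib,
    W.sum_mul_muLaplacian_comm hw hf]
  ring

theorem inv_le_energy {S : Finset V} {f w : V → ℝ} {N : ℝ} (hN : 0 < N)
    (hf : ∀ z ∉ S, f z = 0) (hw : ∀ z ∉ S, w z = 0)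
    (hfw : ∑ x ∈ S, f x * W.muLaplacian w x = -1) (hwN : W.energy S w ≤ N) :
    N⁻¹ ≤ W.energy S f := by
  have hw_smul : ∀ z ∉ S, (N⁻¹ • w) z = 0 := fun z hz => by
    rw [Pi.smul_apply, hw z hz, smul_zero]
  have hnonneg : 0 ≤ W.energy S (f - N⁻¹ • w) :=
    neg_nonneg.2 (W.sum_mul_muLaplacian_self_nonpos fun z hz => by
      rw [Pi.sub_apply, hf z hz, hw_smul z hz, sub_zero])
  have hcross : ∑ x ∈ S, f x * W.muLaplacian (N⁻¹ • w) x = - N⁻¹ := by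
    simp only [map_smul, Pi.smul_apply, smul_eq_mul, mul_left_comm _ N⁻¹, ← Finset.mul_sum, hfw,
      mul_neg_one]
  have hscaled : N⁻¹ ^ 2 * W.energy S w ≤ N⁻¹ :=
    calc N⁻¹ ^ 2 * W.energy S w ≤ N⁻¹ ^ 2 * N := mul_le_mul_of_nonneg_left hwN (by positivity)
      _ = N⁻¹ := by field_simp
  rw [W.energy_sub hf hw_smul, W.energy_smul, hcross] at hnonneg
  linarith

variable [Infinite V]

theorem innerMu_neg_laplacian {f : V → ℝ} {S : Finset V} (hf : ∀ y ∉ S, f y = 0) :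
    W.innerMu (fun x => - W.laplacian f x) f = W.energy S f := by
  rw [innerMu, tsum_eq_sum (s := S) fun y hy => by rw [hf y hy, mul_zero, zero_mul], energy,
    ← Finset.sum_neg_distrib]
  refine Finset.sum_congr rfl fun x _ => ?_
  rw [← laplacian_mul_mass, mass]
  ring

theorem energy_min_green_le {A : Finset V} {x : V} (hx : x ∈ A) {M : ℝ} (hM : 0 ≤ M) :
    W.energy A (fun z => min (W.green A x z) M) ≤ M := by
  set w : V → ℝ := fun z => min (W.green A x z) M
  have hw : ∀ z ∈ A, W.muLaplacian w z ≤ 0 := fun z hz =>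
    W.muLaplacian_min_const_nonpos (W.muLaplacian_green_nonpos x hz) M
  have htotal : ∑ z ∈ A, W.muLaplacian (W.green A x - w) z ≤ 0 :=
    W.sum_muLaplacian_nonpos
      (fun z hz => by
        rw [Pi.sub_apply, W.green_of_notMem_right x hz, zero_sub, neg_eq_zero]
        exact W.min_green_of_notMem x hM hz)
      fun z => sub_nonneg.2 (min_le_left _ _)
  have hgreen : ∑ z ∈ A, W.muLaplacian (W.green A x) z = -1 := by
    simpa using W.sum_mul_muLaplacian_green (fun _ => 1) hx
  simp only [map_sub, Pi.sub_apply, Finset.sum_sub_distrib, hgreen] at htotal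
  calc W.energy A w = ∑ z ∈ A, w z * - W.muLaplacian w z := by
        simp only [energy, mul_neg, Finset.sum_neg_distrib]
    _ ≤ ∑ z ∈ A, M * - W.muLaplacian w z := Finset.sum_le_sum fun z hz =>
        mul_le_mul_of_nonneg_right (min_le_right _ _) (neg_nonneg.2 (hw z hz))
    _ = M * - ∑ z ∈ A, W.muLaplacian w z := by rw [← Finset.mul_sum, Finset.sum_neg_distrib]
    _ ≤ M * 1 := mul_le_mul_of_nonneg_left (by linarith) hM
    _ = M := mul_one M

theorem le_annulusResistance {x : V} {R κ : ℝ} (hR : 0 < R) (hκ : 0 < κ)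
    (h : ∀ y, (W.graph.dist x y : ℝ) < R → κ ≤ W.ballGreen x (2 * R) y) :
    ENNReal.ofReal κ ≤ W.annulusResistance x R (2 * R) := by
  set w : V → ℝ := fun z => min (W.ballGreen x (2 * R) z) κ
  have hsupp : ∀ z ∉ W.ballFinset x (2 * R), (κ⁻¹ • w) z = 0 := fun z hz => by
    rw [Pi.smul_apply, smul_eq_mul, mul_eq_zero]
    exact Or.inr (W.min_green_of_notMem x hκ.le hz)
  let f : V →₀ ℝ := Finsupp.onFinset (W.ballFinset x (2 * R)) (κ⁻¹ • w) fun z hz =>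
    by_contra fun hc => hz (hsupp z hc)
  have hf_one : ∀ z ∈ W.ball x R, f z = 1 := fun z hz => by
    have hw : w z = κ := min_eq_right (h z hz)
    change κ⁻¹ * w z = 1
    rw [hw, inv_mul_cancel₀ hκ.ne']
  have hf_zero : ∀ z ∈ (W.ball x (2 * R))ᶜ, f z = 0 := fun z hz =>
    hsupp z (mt mem_ballFinset.1 hz)
  have henergy : W.innerMu (fun z => - W.laplacian f z) f ≤ κ⁻¹ :=
    calc W.innerMu (fun z => - W.laplacian f z) f
        = κ⁻¹ ^ 2 * W.energy (W.ballFinset x (2 * R)) w :=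
          (W.innerMu_neg_laplacian (f := f) hsupp).trans (W.energy_smul _ _ _)
      _ ≤ κ⁻¹ ^ 2 * κ := mul_le_mul_of_nonneg_left
          (W.energy_min_green_le (W.self_mem_ballFinset x (by positivity)) hκ.le) (by positivity)
      _ = κ⁻¹ := by field_simp
  rw [annulusResistance, resistance, ENNReal.le_inv_iff_le_inv, ← ENNReal.ofReal_inv_of_pos hκ]
  exact (iInf₂_le f ⟨hf_one, hf_zero⟩).trans (ENNReal.ofReal_le_ofReal henergy)

variable {W} {p : ℝ} {x : V} {R M : ℝ}

theorem Elliptic.dist_lt_of_adj (hp : W.Elliptic p) (hR : 1 / 2 < R)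
    (h : ∀ y, R ≤ W.graph.dist x y → W.ballGreen x (2 * R) y ≤ M) {y z : V}
    (hz : (W.graph.dist x z : ℝ) < R) (hgreen : M / p < W.ballGreen x (2 * R) z)
    (hzy : W.graph.Adj z y) : (W.graph.dist x y : ℝ) < R := by
  by_contra! hy
  have hyx : y ≠ x := by
    rintro rfl
    rw [SimpleGraph.dist_self, Nat.cast_zero] at hy
    linarith
  have hstep : p * W.ballGreen x (2 * R) z ≤ W.ballGreen x (2 * R) y :=
    hp.mul_le_of_adj (W.muLaplacian_green_of_ne
      (mem_ballFinset.2 (W.cast_dist_lt_two_mul_of_adj hR hz hzy)) hyx).le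
      (fun _ _ => W.green_nonneg _ _ _) hzy.symm
  rw [div_lt_iff₀' hp.pos] at hgreen
  linarith [h y hy]

theorem Elliptic.sum_mul_muLaplacian_min_ballGreen (hp : W.Elliptic p) (hR : 1 / 2 < R)
    (hM : 0 < M) (h : ∀ y, R ≤ W.graph.dist x y → W.ballGreen x (2 * R) y ≤ M) {f : V → ℝ}
    (hf_one : ∀ z, (W.graph.dist x z : ℝ) < R → f z = 1)
    (hf_zero : ∀ z ∉ W.ballFinset x (2 * R), f z = 0) :
    ∑ z ∈ W.ballFinset x (2 * R),
      f z * W.muLaplacian (fun y => min (W.ballGreen x (2 * R) y) (M / p)) z = -1 := by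
  have hN : 0 ≤ M / p := (div_pos hM hp.pos).le
  have hMN : M ≤ M / p := le_div_self hM.le hp.pos hp.le_one
  set A := W.ballFinset x (2 * R)
  set w : V → ℝ := fun y => min (W.ballGreen x (2 * R) y) (M / p)
  have hexcess : ∀ z ∉ A, (W.green A x - w) z = 0 := fun z hz => by
    rw [Pi.sub_apply, W.green_of_notMem_right x hz, zero_sub, neg_eq_zero]
    exact W.min_green_of_notMem x hN hz
  have horth : ∑ z ∈ A, f z * W.muLaplacian (W.green A x - w) z = 0 := by
    rw [W.sum_mul_muLaplacian_comm hf_zero hexcess]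
    refine Finset.sum_eq_zero fun z _ => ?_
    rcases le_or_gt (W.ballGreen x (2 * R) z) (M / p) with hz | hz
    · exact mul_eq_zero_of_left (sub_eq_zero.2 (min_eq_left hz).symm) _
    · have hzR : (W.graph.dist x z : ℝ) < R := by
        by_contra! hc
        linarith [h z hc]
      rw [W.muLaplacian_congr (v := fun _ => 1) (hf_one z hzR) fun y hy =>
        hf_one y (hp.dist_lt_of_adj hR h hzR hz hy), muLaplacian_const, mul_zero]
  have hgreen : ∑ z ∈ A, f z * W.muLaplacian (W.green A x) z = -1 := by
    rw [W.sum_mul_muLaplacian_green f (W.self_mem_ballFinset x (by linarith)),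
      hf_one x (by rw [SimpleGraph.dist_self, Nat.cast_zero]; linarith)]
  simp only [map_sub, Pi.sub_apply, mul_sub, Finset.sum_sub_distrib, hgreen] at horth
  linarith

theorem Elliptic.annulusResistance_le (hp : W.Elliptic p) (hR : 1 / 2 < R) (hM : 0 < M)
    (h : ∀ y, R ≤ W.graph.dist x y → W.ballGreen x (2 * R) y ≤ M) :
    W.annulusResistance x R (2 * R) ≤ ENNReal.ofReal (M / p) := by
  have hN : 0 < M / p := div_pos hM hp.pos
  rw [annulusResistance, resistance, ENNReal.inv_le_iff_inv_le, ← ENNReal.ofReal_inv_of_pos hN]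
  refine le_iInf₂ fun f ⟨hf_one, hf_compl⟩ => ENNReal.ofReal_le_ofReal ?_
  have hf_zero : ∀ z ∉ W.ballFinset x (2 * R), f z = 0 := fun z hz =>
    hf_compl z (mt mem_ballFinset.2 hz)
  rw [W.innerMu_neg_laplacian hf_zero]
  exact W.inv_le_energy hN hf_zero (fun z hz => W.min_green_of_notMem x hN.le hz)
    (hp.sum_mul_muLaplacian_min_ballGreen hR hM h hf_one hf_zero)
    (W.energy_min_green_le (W.self_mem_ballFinset x (by linarith)) hN.le)

end Resistance

section Radii

theorem cast_ceil_add_lt_two_mul {R : ℝ} (hR : 1 / 2 < R) {e : ℕ} (he : 3 * e ≤ ⌈R⌉₊) :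
    ((⌈R⌉₊ + e : ℕ) : ℝ) < 2 * R := by
  have hceil : (⌈R⌉₊ : ℝ) < R + 1 := Nat.ceil_lt_add_one (by linarith)
  have he' : 3 * (e : ℝ) ≤ ⌈R⌉₊ := by exact_mod_cast he
  push_cast
  rcases Nat.eq_zero_or_pos e with rfl | hpos
  · rcases le_or_gt R 1 with hR1 | hR1
    · have hone : (⌈R⌉₊ : ℝ) ≤ 1 := by exact_mod_cast Nat.ceil_le.2 (by simpa using hR1)
      simpa using hone.trans_lt (by linarith)
    · simpa using hceil.trans (by linarith)
  · have hpos' : (1 : ℝ) ≤ e := by exact_mod_cast hpos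
    linarith

theorem six_mul_le_of_cast_lt {d n : ℕ} (h : (d : ℝ) < 2 * max ((n : ℝ) / 12) (1 / 2)) :
    6 * d ≤ n := by
  rw [mul_max_of_nonneg _ _ zero_le_two, lt_max_iff] at h
  rcases h with h | h
  · have h6 : (6 * d : ℝ) < n := by linarith
    exact_mod_cast h6.le
  · have hd : (d : ℝ) < 1 := h.trans_eq (by norm_num)
    have hd : d = 0 := Nat.lt_one_iff.1 (by exact_mod_cast hd)
    omega

theorem le_two_mul_max_ceil_sub_one (s : ℝ) : s ≤ 2 * (max 1 (⌈s⌉₊ - 1) : ℕ) := by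
  have hceil : ⌈s⌉₊ ≤ 2 * max 1 (⌈s⌉₊ - 1) := by omega
  exact (Nat.le_ceil s).trans (by exact_mod_cast hceil)

end Radii

section Harnack

variable {V : Type*} (W : WeightedGraph V) [W.graph.LocallyFinite]

/-- The elliptic Harnack inequality with constant `H` for functions that are nonnegative
everywhere. -/
structure Harnack (H : ℝ) : Prop where
  one_le : 1 ≤ H
  le_mul : ∀ (x : V) (R : ℝ) (u : V → ℝ), 0 < R →
    (∀ z, (W.graph.dist x z : ℝ) < 2 * R → W.muLaplacian u z = 0) → (∀ z, 0 ≤ u z) →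
    ∀ y, (W.graph.dist x y : ℝ) < R → ∀ z, (W.graph.dist x z : ℝ) < R → u y ≤ H * u z

variable {W} [Infinite V] {p H : ℝ}

theorem EllipticHarnack.exists_harnack (h : W.EllipticHarnack) : ∃ H, W.Harnack H := by
  obtain ⟨H, hH, h⟩ := h
  exact ⟨H, hH.le, fun x R u hR hu hnonneg y hy z hz =>
    h x R hR u (W.harmonicOn_iff.2 fun w hw => hu w hw) (fun w _ => hnonneg w) y hy z hz⟩

section Chain

variable {u : V → ℝ} {s : ℝ}

theorem Harnack.div_mul_le_of_dist_le (hp : W.Elliptic p) (hH : W.Harnack H) (hs : 0 < s)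
    (hnonneg : ∀ z, 0 ≤ u z) {y z : V}
    (hy : ∀ w, (W.graph.dist y w : ℝ) < 2 * s → W.muLaplacian u w = 0)
    (hz : W.muLaplacian u z = 0) (hyz : W.graph.dist y z ≤ max 1 (⌈s⌉₊ - 1)) :
    p / H * u y ≤ u z := by
  have hH0 : 0 < H := zero_lt_one.trans_le hH.one_le
  have hqp : p / H ≤ p := div_le_self hp.pos.le hH.one_le
  rcases le_or_gt (W.graph.dist y z) 1 with h | h
  · calc p / H * u y ≤ p * u y := mul_le_mul_of_nonneg_right hqp (hnonneg y)
      _ ≤ u z := hp.mul_le_of_dist_le_one hz.le (hnonneg z) (fun w _ => hnonneg w) h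
  · have hdist : (W.graph.dist y z : ℝ) < s := Nat.lt_ceil.1 (by omega)
    have hle := hH.le_mul y s u hs hy hnonneg y (by simpa using hs) z hdist
    calc p / H * u y ≤ p / H * (H * u z) :=
          mul_le_mul_of_nonneg_left hle (div_pos hp.pos hH0).le
      _ = p * u z := by field_simp
      _ ≤ u z := mul_le_of_le_one_left (hnonneg z) hp.le_one

theorem Harnack.pow_mul_le_of_harmonic_near_geodesics (hp : W.Elliptic p) (hH : W.Harnack H)
    (hs : 0 < s) (hnonneg : ∀ z, 0 ≤ u z) {a b : V} {n : ℕ} (hn : W.graph.dist a b ≤ n * s)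
    (hu : ∀ z ∈ W.geodesicInterval a b, ∀ w, (W.graph.dist z w : ℝ) < 2 * s →
      W.muLaplacian u w = 0) :
    (p / H) ^ (2 * n) * u a ≤ u b := by
  have hq : 0 ≤ p / H := (div_pos hp.pos (zero_lt_one.trans_le hH.one_le)).le
  refine W.geodesic_chain (P := fun y α => α ≤ u y) (k := max 1 (⌈s⌉₊ - 1)) hq
    (fun y hy z hz hyz α _ hα => ?_) ?_ (hnonneg a) le_rfl
  · exact (mul_le_mul_of_nonneg_left hα hq).trans
      (hH.div_mul_le_of_dist_le hp hs hnonneg (hu y hy) (hu z hz z (by simpa using hs)) hyz)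
  · have hsteps : (W.graph.dist a b : ℝ) ≤ 2 * n * (max 1 (⌈s⌉₊ - 1) : ℕ) :=
      calc (W.graph.dist a b : ℝ) ≤ n * s := hn
        _ ≤ n * (2 * (max 1 (⌈s⌉₊ - 1) : ℕ)) :=
            mul_le_mul_of_nonneg_left (le_two_mul_max_ceil_sub_one s) (Nat.cast_nonneg n)
        _ = 2 * n * (max 1 (⌈s⌉₊ - 1) : ℕ) := by ring
    exact_mod_cast hsteps

end Chain

section Sphere

variable {x a b z w : V} {R : ℝ}

theorem muLaplacian_green_of_near_radius (hR : 1 / 2 < R) (ha : W.graph.dist x a = ⌈R⌉₊)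
    (hb : W.graph.dist x b = ⌈R⌉₊) (hab : ⌈R⌉₊ < 3 * W.graph.dist a b)
    (hz : z ∈ W.geodesicInterval x b) (hw : 6 * W.graph.dist z w ≤ ⌈R⌉₊) :
    W.muLaplacian (W.green (W.ballFinset x (2 * R)) a) w = 0 := by
  have hz : W.graph.dist x z + W.graph.dist z b = W.graph.dist x b := hz
  have hxw : W.graph.dist x w ≤ W.graph.dist x z + W.graph.dist z w := W.connected.dist_triangle
  refine W.muLaplacian_green_of_ne (mem_ballFinset.2 ?_) ?_
  · refine lt_of_le_of_lt (Nat.cast_le.2 ?_)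
      (cast_ceil_add_lt_two_mul hR (e := W.graph.dist z w) (by omega))
    omega
  · rintro rfl
    have hwb : W.graph.dist w b ≤ W.graph.dist w z + W.graph.dist z b := W.connected.dist_triangle
    rw [SimpleGraph.dist_comm (u := w) (v := z)] at hwb
    omega

theorem muLaplacian_ballGreen_of_near_chord (hR : 1 / 2 < R) (ha : W.graph.dist x a = ⌈R⌉₊)
    (hb : W.graph.dist x b = ⌈R⌉₊) (hab : 3 * W.graph.dist a b ≤ ⌈R⌉₊)
    (hz : z ∈ W.geodesicInterval a b) (hw : 6 * W.graph.dist z w ≤ ⌈R⌉₊) :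
    W.muLaplacian (W.ballGreen x (2 * R)) w = 0 := by
  have hR_pos : 0 < ⌈R⌉₊ := Nat.ceil_pos.2 (by linarith)
  have hz : W.graph.dist a z + W.graph.dist z b = W.graph.dist a b := hz
  have hbz : W.graph.dist b z = W.graph.dist z b := SimpleGraph.dist_comm
  have hxw : W.graph.dist x w ≤ W.graph.dist x z + W.graph.dist z w := W.connected.dist_triangle
  have hxz_a : W.graph.dist x z ≤ W.graph.dist x a + W.graph.dist a z := W.connected.dist_triangle
  have hxz_b : W.graph.dist x z ≤ W.graph.dist x b + W.graph.dist b z := W.connected.dist_triangle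
  refine W.muLaplacian_green_of_ne (mem_ballFinset.2 ?_) ?_
  · refine lt_of_le_of_lt (Nat.cast_le.2 ?_) (cast_ceil_add_lt_two_mul hR
      (e := min (W.graph.dist a z) (W.graph.dist z b) + W.graph.dist z w) (by omega))
    omega
  · rintro rfl
    have hwa : W.graph.dist w a ≤ W.graph.dist w z + W.graph.dist z a := W.connected.dist_triangle
    have hwb : W.graph.dist w b ≤ W.graph.dist w z + W.graph.dist z b := W.connected.dist_triangle
    rw [SimpleGraph.dist_comm (u := z) (v := a)] at hwa
    rw [SimpleGraph.dist_comm (u := w) (v := z)] at hwa hwb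
    omega

/- If `a` and `b` are far apart, then both `g(x,a)` and `g(x,b)` are compared with `g(a,b)`: a
geodesic from `x` to `b` stays away from `a`, and one from `a` to `x` stays away from `b`.
Otherwise a geodesic from `a` to `b` stays away from `x`. -/
theorem Harnack.pow_mul_ballGreen_le (hp : W.Elliptic p) (hH : W.Harnack H) (hR : 1 / 2 < R)
    (ha : W.graph.dist x a = ⌈R⌉₊) (hb : W.graph.dist x b = ⌈R⌉₊) :
    (p / H) ^ 48 * W.ballGreen x (2 * R) a ≤ W.ballGreen x (2 * R) b := by
  have hq : 0 ≤ p / H := (div_pos hp.pos (zero_lt_one.trans_le hH.one_le)).le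
  set s : ℝ := max ((⌈R⌉₊ : ℝ) / 12) (1 / 2)
  have hs_pos : 0 < s := lt_max_of_lt_right (by norm_num)
  have hceil : (⌈R⌉₊ : ℝ) ≤ 12 * s := by linarith [le_max_left ((⌈R⌉₊ : ℝ) / 12) (1 / 2)]
  rcases lt_or_ge ⌈R⌉₊ (3 * W.graph.dist a b) with hab | hab
  · set A := W.ballFinset x (2 * R)
    have hxb : (p / H) ^ (2 * 12) * W.green A a x ≤ W.green A a b :=
      hH.pow_mul_le_of_harmonic_near_geodesics hp hs_pos (fun z => W.green_nonneg _ _ _)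
        (by rw [hb]; exact_mod_cast hceil) fun z hz w hw =>
          muLaplacian_green_of_near_radius hR ha hb hab hz (six_mul_le_of_cast_lt hw)
    have hax : (p / H) ^ (2 * 12) * W.green A b a ≤ W.green A b x :=
      hH.pow_mul_le_of_harmonic_near_geodesics hp hs_pos (fun z => W.green_nonneg _ _ _)
        (by rw [SimpleGraph.dist_comm, ha]; exact_mod_cast hceil) fun z hz w hw =>
          muLaplacian_green_of_near_radius hR hb ha (by rwa [SimpleGraph.dist_comm])
            (W.geodesicInterval_comm a x ▸ hz) (six_mul_le_of_cast_lt hw)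
    calc (p / H) ^ 48 * W.green A x a
        = (p / H) ^ (2 * 12) * ((p / H) ^ (2 * 12) * W.green A a x) := by
          rw [W.green_symm A x a]
          ring
      _ ≤ (p / H) ^ (2 * 12) * W.green A b a := by
          rw [W.green_symm A b a]
          exact mul_le_mul_of_nonneg_left hxb (by positivity)
      _ ≤ W.green A x b := W.green_symm A x b ▸ hax
  · have hab' : 3 * (W.graph.dist a b : ℝ) ≤ ⌈R⌉₊ := by exact_mod_cast hab
    exact hH.pow_mul_le_of_harmonic_near_geodesics (n := 24) hp hs_pos
      (fun z => W.green_nonneg _ _ _) (by push_cast; linarith) fun z hz w hw =>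
        muLaplacian_ballGreen_of_near_chord hR ha hb hab hz (six_mul_le_of_cast_lt hw)

end Sphere

end Harnack

section SphereToBall

variable {V : Type*} {W : WeightedGraph V} [W.graph.LocallyFinite] [Infinite V] {x y : V} {R : ℝ}

theorem Elliptic.ballGreen_pos {p : ℝ} (hp : W.Elliptic p) (h : (W.graph.dist x y : ℝ) < R) :
    0 < W.ballGreen x R y := by
  have hself : 0 < W.ballGreen x R x :=
    pos_of_mul_pos_left (zero_lt_one.trans_le
      (W.one_le_ballGreen_self_mul_mass x ((Nat.cast_nonneg _).trans_lt h))) (W.mass_nonneg x)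
  refine (mul_pos (pow_pos hp.pos (W.graph.dist x y)) hself).trans_le
    (W.geodesic_chain (P := fun z α => α ≤ W.ballGreen x R z) (k := 1) hp.pos.le
      (fun v _ w hw hvw α _ hα => ?_) (mul_one _).ge hself.le le_rfl)
  have hw_mem : w ∈ W.ballFinset x R :=
    mem_ballFinset.2 ((Nat.cast_le.2 (Nat.le.intro hw)).trans_lt h)
  exact (mul_le_mul_of_nonneg_left hα hp.pos.le).trans
    (hp.mul_le_of_dist_le_one (W.muLaplacian_green_nonpos x hw_mem) (W.green_nonneg _ _ _)
      (fun _ _ => W.green_nonneg _ _ _) hvw)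

theorem ballGreen_le_of_sphere {n : ℕ} {M : ℝ} (hM : 0 ≤ M)
    (h : ∀ a, W.graph.dist x a = n → W.ballGreen x R a ≤ M) (hy : n ≤ W.graph.dist x y) :
    W.ballGreen x R y ≤ M := by
  rcases hy.eq_or_lt with hy | hy
  · exact h y hy.symm
  rcases le_or_gt R (W.graph.dist x y) with hyR | hyR
  · exact (W.ballGreen_of_le_dist hyR).trans_le hM
  refine W.le_of_muLaplacian_le (A := (W.ballFinset x R).filter fun z => n < W.graph.dist x z)
    (u := W.ballGreen x R) (v := fun _ => M) (fun z hz => ?_) (fun z hz w hzw hw => ?_) y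
    (Finset.mem_filter.2 ⟨mem_ballFinset.2 hyR, hy⟩)
  · rw [Finset.mem_filter] at hz
    have hzx : z ≠ x := by
      rintro rfl
      exact absurd hz.2 (by rw [SimpleGraph.dist_self]; exact Nat.not_lt_zero n)
    exact (W.muLaplacian_const M z).trans_le (W.muLaplacian_green_of_ne hz.1 hzx).ge
  · rw [Finset.mem_filter] at hz hw
    rcases le_or_gt R (W.graph.dist x w) with hwR | hwR
    · exact (W.ballGreen_of_le_dist hwR).trans_le hM
    · have hzn := W.dist_le_add_one_of_adj (x := x) hzw.symm
      have hwn : ¬ n < W.graph.dist x w := fun hlt => hw ⟨mem_ballFinset.2 hwR, hlt⟩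
      exact h w (by omega)

theorem le_ballGreen_of_sphere {n : ℕ} {m : ℝ} (hn : n ≤ R)
    (h : ∀ a, W.graph.dist x a = n → m ≤ W.ballGreen x R a) (hy : W.graph.dist x y < n) :
    m ≤ W.ballGreen x R y := by
  refine W.le_of_muLaplacian_le (A := W.ballFinset x n) (u := fun _ => m) (v := W.ballGreen x R)
    (fun z hz => ?_) (fun z hz w hzw hw => ?_) y (mem_ballFinset.2 (Nat.cast_lt.2 hy))
  · exact (W.muLaplacian_green_nonpos x (W.ballFinset_mono x hn hz)).trans
      (W.muLaplacian_const m z).ge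
  · rw [mem_ballFinset, Nat.cast_lt] at hz hw
    have hwn := W.dist_le_add_one_of_adj (x := x) hzw
    exact h w (by omega)

theorem greenScale_of_le_half (hR : 0 < R) (hR_half : R ≤ 1 / 2) :
    W.greenScale x R = W.ballGreen x (2 * R) x := by
  rw [greenScale, ballExitTime, ballVolume, W.ballFinset_eq_singleton x hR (by linarith),
    W.ballFinset_eq_singleton x (r := 2 * R) (by linarith) (by linarith), Finset.sum_singleton,
    Finset.sum_singleton, mul_div_cancel_right₀ _ (W.mass_pos x).ne']

end SphereToBall

section GreenBounds

variable {V : Type*} {W : WeightedGraph V} [W.graph.LocallyFinite] [Infinite V] {p H : ℝ}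

theorem Harnack.exists_ballGreen_bounds (hp : W.Elliptic p) (hH : W.Harnack H) {x : V} {R : ℝ}
    (hR : 1 / 2 < R) :
    ∃ t > 0, (∀ y, R ≤ W.graph.dist x y → W.ballGreen x (2 * R) y ≤ ((p / H) ^ 48)⁻¹ * t) ∧
      ∀ y, (W.graph.dist x y : ℝ) < R → (p / H) ^ 48 * t ≤ W.ballGreen x (2 * R) y := by
  have hq : 0 < p / H := div_pos hp.pos (zero_lt_one.trans_le hH.one_le)
  have hceil : (⌈R⌉₊ : ℝ) < 2 * R := by
    simpa using cast_ceil_add_lt_two_mul hR (e := 0) (Nat.zero_le _)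
  obtain ⟨b, hb⟩ := W.exists_dist_eq x ⌈R⌉₊
  have ht : 0 < W.ballGreen x (2 * R) b := hp.ballGreen_pos (hb ▸ hceil)
  refine ⟨W.ballGreen x (2 * R) b, ht, fun y hy => ?_, fun y hy => ?_⟩
  · refine ballGreen_le_of_sphere (by positivity) (fun a ha => ?_) (Nat.ceil_le.2 hy)
    rw [inv_mul_eq_div, le_div_iff₀' (pow_pos hq 48)]
    exact hH.pow_mul_ballGreen_le hp hR ha hb
  · exact le_ballGreen_of_sphere hceil.le (fun a ha => hH.pow_mul_ballGreen_le hp hR hb ha)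
      (Nat.lt_ceil.2 hy)

theorem GreenBounds.of_half_lt {C c : ℝ} (hC : 1 ≤ C) (hc : 0 < c) (hc_one : c ≤ 1)
    (hupper : ∀ (x : V) (R : ℝ), 1 / 2 < R → ∀ y, R ≤ W.graph.dist x y →
      W.ballGreen x (2 * R) y ≤ C * W.greenScale x R)
    (hlower : ∀ (x : V) (R : ℝ), 1 / 2 < R → ∀ y, (W.graph.dist x y : ℝ) < R →
      c * W.greenScale x R ≤ W.ballGreen x (2 * R) y) :
    W.GreenBounds C c := by
  refine ⟨hC, hc, hc_one, fun x R hR y hy => ?_, fun x R hR y hy => ?_⟩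
  · rcases lt_or_ge (1 / 2) R with hR_half | hR_half
    · exact hupper x R hR_half y hy
    · have hxy : 1 ≤ W.graph.dist x y := Nat.cast_pos.1 (hR.trans_le hy)
      have hxy : (1 : ℝ) ≤ W.graph.dist x y := by exact_mod_cast hxy
      rw [W.ballGreen_of_le_dist (by linarith)]
      exact mul_nonneg (zero_le_one.trans hC) (W.greenScale_pos x hR).le
  · rcases lt_or_ge (1 / 2) R with hR_half | hR_half
    · exact hlower x R hR_half y hy
    · obtain rfl := W.eq_of_cast_dist_lt_one (hy.trans_le (by linarith))
      rw [greenScale_of_le_half hR hR_half]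
      exact mul_le_of_le_one_left (W.ballGreen_nonneg _ _ _) hc_one

theorem Harnack.greenBounds (hp : W.Elliptic p) (hH : W.Harnack H) {C : ℝ} (hC : 0 < C)
    (hscale : ∀ (x : V) (R K : ℝ), 1 / 2 < R → 0 ≤ K →
      W.annulusResistance x R (2 * R) ≤ ENNReal.ofReal K → W.greenScale x R ≤ C * K) :
    W.GreenBounds ((((p / H) ^ 48)⁻¹) ^ 2) (min 1 (((p / H) ^ 48) ^ 2 * p / C)) := by
  have hq : 0 < p / H := div_pos hp.pos (zero_lt_one.trans_le hH.one_le)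
  have hq_one : p / H ≤ 1 := (div_le_self hp.pos.le hH.one_le).trans hp.le_one
  have hp_pos := hp.pos
  have hbounds := fun x R hR => hH.exists_ballGreen_bounds (x := x) (R := R) hp hR
  have hQ_one : 1 ≤ (((p / H) ^ 48)⁻¹) ^ 2 :=
    one_le_pow₀ (one_le_inv₀ (pow_pos hq 48) |>.2 (pow_le_one₀ hq.le hq_one))
  have hQ : 0 < (p / H) ^ 48 := pow_pos hq 48
  generalize (p / H) ^ 48 = Q at hbounds hQ hQ_one
  refine .of_half_lt hQ_one (by positivity) (min_le_left _ _) (fun x R hR y hy => ?_)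
    fun x R hR y hy => ?_
  · obtain ⟨t, -, hupper, hlower⟩ := hbounds x R hR
    have hR_pos : 0 < R := by linarith
    have ht : Q * t ≤ W.greenScale x R := (le_div_iff₀ (W.ballVolume_pos x hR_pos)).2
      (mul_ballVolume_le_ballExitTime hR_pos hlower)
    calc W.ballGreen x (2 * R) y ≤ Q⁻¹ * t := hupper y hy
      _ = Q⁻¹ ^ 2 * (Q * t) := by field_simp
      _ ≤ Q⁻¹ ^ 2 * W.greenScale x R := by gcongr
  · obtain ⟨t, ht, hupper, hlower⟩ := hbounds x R hR
    have hscale_le : W.greenScale x R ≤ C * (Q⁻¹ * t / p) :=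
      hscale x R _ hR (by positivity) (hp.annulusResistance_le hR (by positivity) hupper)
    calc min 1 (Q ^ 2 * p / C) * W.greenScale x R ≤ Q ^ 2 * p / C * W.greenScale x R :=
          mul_le_mul_of_nonneg_right (min_le_right _ _) (W.greenScale_pos x (by linarith)).le
      _ ≤ Q ^ 2 * p / C * (C * (Q⁻¹ * t / p)) := by gcongr
      _ = Q * t := by field_simp
      _ ≤ W.ballGreen x (2 * R) y := hlower y hy

variable [Countable V] [MeasurableSpace V] [DiscreteMeasurableSpace V]

theorem EinsteinRelation.exists_greenScale_le (h : W.EinsteinRelation) {D : ℝ}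
    (hD : W.Doubling D) : ∃ C : ℝ, 0 < C ∧ ∀ (x : V) (R K : ℝ), 1 / 2 < R → 0 ≤ K →
      W.annulusResistance x R (2 * R) ≤ ENNReal.ofReal K → W.greenScale x R ≤ C * K := by
  obtain ⟨C, hC, h⟩ := h
  refine ⟨C * D, mul_pos hC (zero_lt_one.trans_le hD.one_le), fun x R K hR hK hρ => ?_⟩
  have hR_pos : 0 < R := by linarith
  have hvol : W.annulusVol x R (2 * R) ≤ ENNReal.ofReal (W.ballVolume x (2 * R)) := by
    rw [← vol_eq_ofReal]
    exact tsub_le_self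
  have hexit : W.meanExit x (2 * R) ≤ ENNReal.ofReal (C * (K * W.ballVolume x (2 * R))) := by
    rw [ENNReal.ofReal_mul (NNReal.coe_nonneg C), ENNReal.ofReal_mul hK, ENNReal.ofReal_coe_nnreal]
    exact (h x R hR).1.trans (mul_le_mul_right (mul_le_mul' hρ hvol) _)
  rw [meanExit_eq_ofReal, ENNReal.ofReal_le_ofReal_iff
    (mul_nonneg (NNReal.coe_nonneg C) (mul_nonneg hK (W.ballVolume_nonneg _ _)))] at hexit
  rw [greenScale, div_le_iff₀ (W.ballVolume_pos x hR_pos)]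
  calc W.ballExitTime x (2 * R) ≤ C * (K * W.ballVolume x (2 * R)) := hexit
    _ ≤ C * (K * (D * W.ballVolume x R)) := by
        gcongr
        exact hD.le_mul x R hR_pos
    _ = C * D * K * W.ballVolume x R := by ring

end GreenBounds

section EinsteinRelation

variable {V : Type*} {W : WeightedGraph V} [W.graph.LocallyFinite]

theorem annulusVol_eq_ofReal (x : V) (r R : ℝ) :
    W.annulusVol x r R = ENNReal.ofReal (W.ballVolume x R - W.ballVolume x r) := by
  rw [annulusVol, vol_eq_ofReal, vol_eq_ofReal, ENNReal.ofReal_sub _ (W.ballVolume_nonneg x r)]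

variable [Infinite V] {R : ℝ}

variable (W) in
theorem exists_ball_subset_annulus (x : V) (hR : 1 / 2 < R) :
    ∃ y, (W.graph.dist x y : ℝ) < 2 * R ∧
      ∀ z ∈ W.ballFinset y (R / 8), R ≤ W.graph.dist x z ∧ (W.graph.dist x z : ℝ) < 2 * R := by
  rcases lt_or_ge R 8 with hR8 | hR8
  · obtain ⟨y, hy⟩ := W.exists_dist_eq x ⌈R⌉₊
    have hy_lt : (W.graph.dist x y : ℝ) < 2 * R := by
      rw [hy]
      simpa using cast_ceil_add_lt_two_mul hR (e := 0) (Nat.zero_le _)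
    refine ⟨y, hy_lt, fun z hz => ?_⟩
    obtain rfl := W.eq_of_cast_dist_lt_one ((mem_ballFinset.1 hz).trans (by linarith))
    exact ⟨hy ▸ Nat.le_ceil R, hy_lt⟩
  · obtain ⟨y, hy⟩ := W.exists_dist_eq x ⌈9 * R / 8⌉₊
    have hle : 9 * R / 8 ≤ W.graph.dist x y := hy ▸ Nat.le_ceil _
    have hlt : (W.graph.dist x y : ℝ) < 9 * R / 8 + 1 := hy ▸ Nat.ceil_lt_add_one (by linarith)
    refine ⟨y, by linarith, fun z hz => ?_⟩
    rw [mem_ballFinset] at hz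
    have hxz := W.cast_dist_triangle x y z
    have hxy := W.cast_dist_triangle x z y
    rw [W.cast_dist_comm z y] at hxy
    exact ⟨by linarith, by linarith⟩

theorem Doubling.ballVolume_le_annulus {D : ℝ} (hD : W.Doubling D) (x : V) (hR : 1 / 2 < R) :
    W.ballVolume x R ≤ D ^ 5 * (W.ballVolume x (2 * R) - W.ballVolume x R) := by
  obtain ⟨y, hy, hannulus⟩ := W.exists_ball_subset_annulus x hR
  have hdisj : Disjoint (W.ballFinset x R) (W.ballFinset y (R / 8)) :=
    Finset.disjoint_right.2 fun z hz hzx => (hannulus z hz).1.not_gt (mem_ballFinset.1 hzx)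
  have hadd : W.ballVolume x R + W.ballVolume y (R / 8) ≤ W.ballVolume x (2 * R) := by
    classical
    rw [ballVolume, ballVolume, ← Finset.sum_union hdisj]
    exact Finset.sum_le_sum_of_subset_of_nonneg
      (Finset.union_subset (W.ballFinset_mono x (by linarith)) fun z hz =>
        mem_ballFinset.2 (hannulus z hz).2) fun _ _ _ => W.mass_nonneg _
  calc W.ballVolume x R ≤ W.ballVolume y (2 ^ 5 * (R / 8)) :=
        W.ballVolume_le_of_subset (W.ballFinset_subset (by rw [W.cast_dist_comm]; linarith))
    _ ≤ D ^ 5 * W.ballVolume y (R / 8) := hD.le_pow_mul y (by linarith) 5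
    _ ≤ D ^ 5 * (W.ballVolume x (2 * R) - W.ballVolume x R) :=
        mul_le_mul_of_nonneg_left (by linarith) (pow_nonneg (zero_le_one.trans hD.one_le) 5)

variable {D C c : ℝ}

theorem GreenBounds.ballExitTime_le (hD : W.Doubling D) (hg : W.GreenBounds C c) (x : V)
    (hR : 1 / 2 < R) :
    ENNReal.ofReal (W.ballExitTime x (2 * R)) ≤ ENNReal.ofReal (D ^ 5 / c) *
      (W.annulusResistance x R (2 * R) * W.annulusVol x R (2 * R)) := by
  have hR_pos : 0 < R := by linarith
  have hD_pos : 0 < D := zero_lt_one.trans_le hD.one_le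
  have hc := hg.pos
  have hscale := W.greenScale_pos x hR_pos
  have hρ := W.le_annulusResistance hR_pos (mul_pos hc hscale) (hg.lower x R hR_pos)
  refine le_trans ?_ (mul_le_mul_right (mul_le_mul_left hρ _) _)
  rw [annulusVol_eq_ofReal, ← ENNReal.ofReal_mul (by positivity),
    ← ENNReal.ofReal_mul (by positivity), ← W.greenScale_mul_ballVolume x hR_pos]
  refine ENNReal.ofReal_le_ofReal ?_
  calc W.greenScale x R * W.ballVolume x R
      ≤ W.greenScale x R * (D ^ 5 * (W.ballVolume x (2 * R) - W.ballVolume x R)) :=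
        mul_le_mul_of_nonneg_left (hD.ballVolume_le_annulus x hR) hscale.le
    _ = D ^ 5 / c * (c * W.greenScale x R * (W.ballVolume x (2 * R) - W.ballVolume x R)) := by
        field_simp

theorem GreenBounds.annulusResistance_mul_annulusVol_le {p : ℝ} (hp : W.Elliptic p)
    (hD : W.Doubling D) (hg : W.GreenBounds C c) (x : V) (hR : 1 / 2 < R) :
    W.annulusResistance x R (2 * R) * W.annulusVol x R (2 * R) ≤
      ENNReal.ofReal (C * D / p) * ENNReal.ofReal (W.ballExitTime x (2 * R)) := by
  have hR_pos : 0 < R := by linarith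
  have hD_pos : 0 < D := zero_lt_one.trans_le hD.one_le
  have hC_pos : 0 < C := zero_lt_one.trans_le hg.one_le
  have hp_pos := hp.pos
  have hscale := W.greenScale_pos x hR_pos
  refine (mul_le_mul_left (hp.annulusResistance_le hR (mul_pos hC_pos hscale)
    (hg.upper x R hR_pos)) _).trans ?_
  rw [annulusVol_eq_ofReal, ← ENNReal.ofReal_mul (by positivity),
    ← ENNReal.ofReal_mul (by positivity), ← W.greenScale_mul_ballVolume x hR_pos]
  refine ENNReal.ofReal_le_ofReal ?_
  calc C * W.greenScale x R / p * (W.ballVolume x (2 * R) - W.ballVolume x R)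
      ≤ C * W.greenScale x R / p * (D * W.ballVolume x R) := by
        gcongr
        exact (sub_le_self _ (W.ballVolume_nonneg x R)).trans (hD.le_mul x R hR_pos)
    _ = C * D / p * (W.greenScale x R * W.ballVolume x R) := by ring

theorem GreenBounds.einsteinRelation [Countable V] [MeasurableSpace V] [DiscreteMeasurableSpace V]
    {p : ℝ} (hp : W.Elliptic p) (hD : W.Doubling D) (hg : W.GreenBounds C c) :
    W.EinsteinRelation := by
  have hpos : 0 < C * D / p := div_pos
    (mul_pos (zero_lt_one.trans_le hg.one_le) (zero_lt_one.trans_le hD.one_le)) hp.pos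
  refine ⟨max (D ^ 5 / c).toNNReal (C * D / p).toNNReal,
    lt_max_of_lt_right (Real.toNNReal_pos.2 hpos), fun x R hR => ?_⟩
  rw [meanExit_eq_ofReal]
  exact ⟨(hg.ballExitTime_le hD x hR).trans
      (mul_le_mul_left (ENNReal.coe_le_coe.2 (le_max_left _ _)) _),
    (hg.annulusResistance_mul_annulusVol_le hp hD x hR).trans
      (mul_le_mul_left (ENNReal.coe_le_coe.2 (le_max_right _ _)) _)⟩

end EinsteinRelation

section HarmonicExtension

variable {V : Type*} (W : WeightedGraph V) [W.graph.LocallyFinite] {A : Finset V} (f : V → ℝ)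

/-- The solution of the Dirichlet problem in the finite set `A` with boundary values `f`: the
function that is harmonic in `A` and equal to `f` off `A`. -/
noncomputable def harmonicExtension (A : Finset V) (f : V → ℝ) : V → ℝ :=
  f + W.greenPotential A (W.muLaplacian f)

theorem harmonicExtension_of_notMem {x : V} (hx : x ∉ A) : W.harmonicExtension A f x = f x := by
  simp [harmonicExtension, greenPotential, W.green_of_notMem_left hx]

theorem harmonicExtension_const (a : ℝ) (x : V) : W.harmonicExtension A (fun _ => a) x = a := by
  simp [harmonicExtension, greenPotential, muLaplacian_const]

theorem harmonicExtension_smul (a : ℝ) (x : V) :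
    W.harmonicExtension A (a • f) x = a * W.harmonicExtension A f x := by
  simp only [harmonicExtension, greenPotential, map_smul, Pi.add_apply, Pi.smul_apply, smul_eq_mul,
    mul_add, Finset.mul_sum, mul_left_comm]

variable [Infinite V]

theorem muLaplacian_harmonicExtension {x : V} (hx : x ∈ A) :
    W.muLaplacian (W.harmonicExtension A f) x = 0 := by
  rw [harmonicExtension, map_add, Pi.add_apply, W.muLaplacian_greenPotential _ hx, add_neg_cancel]

theorem harmonicExtension_mono {f g : V → ℝ} (h : ∀ x ∉ A, f x ≤ g x) (x : V) :
    W.harmonicExtension A f x ≤ W.harmonicExtension A g x := by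
  have hcompl : ∀ y ∉ A, W.harmonicExtension A f y ≤ W.harmonicExtension A g y := fun y hy => by
    rw [W.harmonicExtension_of_notMem f hy, W.harmonicExtension_of_notMem g hy]
    exact h y hy
  by_cases hx : x ∈ A
  · refine W.le_of_muLaplacian_le (A := A) (fun y hy => ?_) (fun _ _ y _ hy => hcompl y hy) x hx
    rw [W.muLaplacian_harmonicExtension f hy, W.muLaplacian_harmonicExtension g hy]
  · exact hcompl x hx

theorem greenPotential_muLaplacian_green_le {B : Finset V} {y z : V} {M : ℝ} (hM : 0 ≤ M)
    (h : ∀ v ∈ A, v ∉ B → ∀ w ∈ B, W.graph.Adj v w → W.green A y v ≤ M) :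
    W.greenPotential A (W.muLaplacian (W.green B z)) y ≤ M := by
  classical
  have hinside : ∀ v ∈ A, v ∈ B → W.green A y v * W.muLaplacian (W.green B z) v ≤ 0 :=
    fun v _ hv => mul_nonpos_of_nonneg_of_nonpos (W.green_nonneg A y v)
      (W.muLaplacian_green_nonpos z hv)
  have houtside : ∀ v ∈ A, v ∉ B → W.green A y v * W.muLaplacian (W.green B z) v
      ≤ M * W.muLaplacian (W.green B z) v := fun v hvA hvB => by
    have hv := W.green_of_notMem_right z hvB
    by_cases hnbr : ∃ w ∈ B, W.graph.Adj v w
    · obtain ⟨w, hw, hvw⟩ := hnbr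
      refine mul_le_mul_of_nonneg_right (h v hvA hvB w hw hvw) ?_
      rw [← W.muLaplacian_const 0 v]
      exact W.muLaplacian_mono hv.symm fun w _ => W.green_nonneg B z w
    · have hzero : W.muLaplacian (W.green B z) v = 0 := by
        rw [← W.muLaplacian_const 0 v]
        exact W.muLaplacian_congr hv fun w hw =>
          W.green_of_notMem_right z fun hwB => hnbr ⟨w, hwB, hw⟩
      rw [hzero, mul_zero, mul_zero]
  calc W.greenPotential A (W.muLaplacian (W.green B z)) y
      ≤ ∑ v ∈ A, if v ∉ B then M * W.muLaplacian (W.green B z) v else 0 :=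
        Finset.sum_le_sum fun v hv => by
          split_ifs with hvB
          exacts [hinside v hv hvB, houtside v hv hvB]
    _ = M * ∑ v ∈ A with v ∉ B, W.muLaplacian (W.green B z) v := by
        rw [← Finset.sum_filter, Finset.mul_sum]
    _ ≤ M * 1 := mul_le_mul_of_nonneg_left (W.sum_muLaplacian_green_le_one
        (Finset.disjoint_left.2 fun v hv => (Finset.mem_filter.1 hv).2) z) hM
    _ = M := mul_one M

end HarmonicExtension

section SuperharmonicGrowth

variable {V : Type*} {W : WeightedGraph V} [W.graph.LocallyFinite]

variable (W) in
/-- A nonnegative function that is superharmonic in `B(y,4r)` and at least `α` on `B(y,r)` is at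
least `qα` on `B(y,2r)`. -/
structure SuperharmonicGrowth (q : ℝ) : Prop where
  pos : 0 < q
  mul_le : ∀ (y : V) (r α : ℝ) (s : V → ℝ), 0 < r → 0 ≤ α → (∀ z, 0 ≤ s z) →
    (∀ z, (W.graph.dist y z : ℝ) < 4 * r → W.muLaplacian s z ≤ 0) →
    (∀ z, (W.graph.dist y z : ℝ) < r → α ≤ s z) →
    ∀ z, (W.graph.dist y z : ℝ) < 2 * r → q * α ≤ s z

theorem SuperharmonicGrowth.pow_mul_le_of_near_geodesics {q : ℝ} (hq : W.SuperharmonicGrowth q)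
    {a b : V} {r α : ℝ} {n : ℕ} (hr : 1 ≤ r) (hα : 0 ≤ α) {s : V → ℝ} (hnonneg : ∀ z, 0 ≤ s z)
    (hn : W.graph.dist a b ≤ n * r)
    (hs : ∀ z ∈ W.geodesicInterval a b, ∀ w, (W.graph.dist z w : ℝ) < 4 * r →
      W.muLaplacian s w ≤ 0)
    (ha : ∀ w, (W.graph.dist a w : ℝ) < r → α ≤ s w) :
    ∀ w, (W.graph.dist b w : ℝ) < r → q ^ (2 * n) * α ≤ s w := by
  have hfloor : (⌊r⌋₊ : ℝ) ≤ r := Nat.floor_le (by linarith)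
  refine W.geodesic_chain (P := fun y β => ∀ w, (W.graph.dist y w : ℝ) < r → β ≤ s w)
    (k := ⌊r⌋₊) hq.pos.le (fun y hy z _ hyz β hβ h w hw => ?_) ?_ hα ha
  · have hyz' : (W.graph.dist y z : ℝ) ≤ ⌊r⌋₊ := by exact_mod_cast hyz
    exact hq.mul_le y r β s (by linarith) hβ hnonneg (hs y hy) h w
      (by linarith [W.cast_dist_triangle y z w])
  · have hr_le : r ≤ 2 * ⌊r⌋₊ := by
      have hone : (1 : ℝ) ≤ ⌊r⌋₊ := by exact_mod_cast Nat.le_floor (by simpa using hr)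
      linarith [Nat.lt_floor_add_one r]
    have hcast : (W.graph.dist a b : ℝ) ≤ (2 * n * ⌊r⌋₊ : ℕ) :=
      calc (W.graph.dist a b : ℝ) ≤ n * r := hn
        _ ≤ n * (2 * ⌊r⌋₊) := mul_le_mul_of_nonneg_left hr_le (Nat.cast_nonneg n)
        _ = (2 * n * ⌊r⌋₊ : ℕ) := by push_cast; ring
    exact_mod_cast hcast

variable (W) in
/-- The probability that the walk started at a given vertex leaves `B(y,R)` through `B(z,t)`,
as the solution of a Dirichlet problem. -/
noncomputable def exitProb (y : V) (R : ℝ) (z : V) (t : ℝ) : V → ℝ :=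
  W.harmonicExtension (W.ballFinset y R) ((W.ball z t).indicator 1)

theorem exitProb_eq_one {y z w : V} {R t : ℝ} (hy : R ≤ W.graph.dist y w)
    (hz : (W.graph.dist z w : ℝ) < t) : W.exitProb y R z t w = 1 :=
  (W.harmonicExtension_of_notMem _ (mt mem_ballFinset.1 hy.not_gt)).trans
    (Set.indicator_of_mem (s := W.ball z t) hz 1)

variable [Infinite V]

variable (W) in
theorem exitProb_nonneg (y : V) (R : ℝ) (z : V) (t : ℝ) (w : V) : 0 ≤ W.exitProb y R z t w := by
  rw [exitProb, ← W.harmonicExtension_const (A := W.ballFinset y R) 0 w]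
  exact W.harmonicExtension_mono (fun v _ => Set.indicator_nonneg (fun _ _ => zero_le_one) v) w

variable (W) in
theorem exitProb_le_one (y : V) (R : ℝ) (z : V) (t : ℝ) (w : V) : W.exitProb y R z t w ≤ 1 := by
  rw [exitProb, ← W.harmonicExtension_const (A := W.ballFinset y R) 1 w]
  exact W.harmonicExtension_mono
    (fun v _ => Set.indicator_le_self' (f := (1 : V → ℝ)) (fun _ _ => zero_le_one) v) w

theorem SuperharmonicGrowth.pow_le_exitProb {q : ℝ} (hq : W.SuperharmonicGrowth q) {y z : V}
    {R t r : ℝ} {n : ℕ} (hr : 1 ≤ r) (hRr : R + r ≤ W.graph.dist z y)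
    (ht : W.graph.dist z y ≤ R + t - 8 * r) (hn : W.graph.dist z y ≤ n * r) :
    q ^ (2 * n) ≤ W.exitProb y R z t y := by
  have hyy : (W.graph.dist y y : ℝ) < r := by
    rw [SimpleGraph.dist_self, Nat.cast_zero]
    linarith
  rw [← mul_one (q ^ (2 * n))]
  refine hq.pow_mul_le_of_near_geodesics hr zero_le_one (W.exitProb_nonneg y R z t) hn
    (fun v hv w hw => ?_) (fun w hw => ?_) y hyy
  · rcases lt_or_ge (W.graph.dist y w : ℝ) R with hyw | hyw
    · exact (W.muLaplacian_harmonicExtension _ (mem_ballFinset.2 hyw)).le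
    · have hv : (W.graph.dist z v : ℝ) + W.graph.dist v y = W.graph.dist z y := by
        exact_mod_cast (show W.graph.dist z v + W.graph.dist v y = W.graph.dist z y from hv)
      have hzw : (W.graph.dist z w : ℝ) < t := by
        linarith [W.cast_dist_triangle y v w, W.cast_dist_triangle z v w, W.cast_dist_comm v y]
      refine W.muLaplacian_nonpos_of_le fun v' _ => ?_
      rw [exitProb_eq_one hyw hzw]
      exact W.exitProb_le_one y R z t v'
  · rw [exitProb_eq_one] <;> linarith [W.cast_dist_triangle z w y, W.cast_dist_comm w y]

end SuperharmonicGrowth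

section GreenScale

variable {V : Type*} {W : WeightedGraph V} [W.graph.LocallyFinite] [Infinite V] {p D C c q : ℝ}

theorem Doubling.greenScale_le (hD : W.Doubling D) (y : V) {r s : ℝ} (hr : 0 < r) (hrs : r ≤ s)
    (hsr : s ≤ 2 * r) : W.greenScale y r ≤ D * W.greenScale y s := by
  have hvol_pos := W.ballVolume_pos y (hr.trans_le hrs)
  have hvol : W.ballVolume y s ≤ D * W.ballVolume y r :=
    (W.ballVolume_le_of_subset (W.ballFinset_mono y hsr)).trans (hD.le_mul y r hr)
  rw [greenScale, greenScale, div_le_iff₀ (W.ballVolume_pos y hr), mul_div_assoc',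
    div_mul_eq_mul_div, le_div_iff₀ hvol_pos]
  calc W.ballExitTime y (2 * r) * W.ballVolume y s
      ≤ W.ballExitTime y (2 * s) * (D * W.ballVolume y r) :=
        mul_le_mul (W.ballExitTime_mono y (by linarith)) hvol hvol_pos.le
          (W.ballExitTime_nonneg _ _)
    _ = D * W.ballExitTime y (2 * s) * W.ballVolume y r := by ring

theorem ballGreen_le_add {y : V} {r s M : ℝ} (hrs : r ≤ s)
    (h : ∀ w, r ≤ W.graph.dist y w → W.ballGreen y s w ≤ M) (w : V) :
    W.ballGreen y s w ≤ W.ballGreen y r w + M := by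
  classical
  rcases le_or_gt r (W.graph.dist y w) with hw | hw
  · linarith [h w hw, W.ballGreen_nonneg y r w]
  · refine W.le_of_muLaplacian_le (A := W.ballFinset y r) (u := W.ballGreen y s)
      (v := W.ballGreen y r + fun _ => M) (fun z hz => ?_) (fun z _ v _ hv => ?_) w
      (mem_ballFinset.2 hw)
    · rw [map_add, Pi.add_apply, muLaplacian_const, add_zero]
      exact ((W.muLaplacian_green y hz).trans
        (W.muLaplacian_green y (W.ballFinset_mono y hrs hz)).symm).le
    · rw [mem_ballFinset, not_lt] at hv
      exact (h v hv).trans (le_add_of_nonneg_left (W.ballGreen_nonneg y r v))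

theorem GreenBounds.ballGreen_le (hD : W.Doubling D) (hg : W.GreenBounds C c) (y : V) {r : ℝ}
    (hr : 0 < r) (k : ℕ) {w : V} (hw : r ≤ W.graph.dist y w) :
    W.ballGreen y (2 * (2 ^ k * r)) w ≤ C * (2 * D) ^ k * W.greenScale y (2 ^ k * r) := by
  have hC : 0 < C := zero_lt_one.trans_le hg.one_le
  have hD_one := hD.one_le
  induction k with
  | zero => simpa using hg.upper y r hr w hw
  | succ k ih =>
    rw [pow_succ' 2 k, mul_assoc 2]
    set s := 2 ^ k * r
    have hs : 0 < s := by positivity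
    have hscale_pos := W.greenScale_pos y (show 0 < 2 * s by positivity)
    have henlarge : W.ballGreen y (2 * (2 * s)) w
        ≤ W.ballGreen y (2 * s) w + C * W.greenScale y (2 * s) :=
      ballGreen_le_add (by linarith) (hg.upper y (2 * s) (by positivity)) w
    have hscale : W.greenScale y s ≤ D * W.greenScale y (2 * s) :=
      hD.greenScale_le y hs (by linarith) le_rfl
    have hone : 1 ≤ (2 * D) ^ k * D :=
      one_le_mul_of_one_le_of_one_le (one_le_pow₀ (by linarith)) hD_one
    calc W.ballGreen y (2 * (2 * s)) w
        ≤ C * (2 * D) ^ k * W.greenScale y s + C * 1 * W.greenScale y (2 * s) := by linarith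
      _ ≤ C * (2 * D) ^ k * (D * W.greenScale y (2 * s))
          + C * ((2 * D) ^ k * D) * W.greenScale y (2 * s) := by gcongr
      _ = C * (2 * D) ^ (k + 1) * W.greenScale y (2 * s) := by ring

theorem Elliptic.ballGreen_le_div (hp : W.Elliptic p) {y : V} {r R M : ℝ} (hr : 0 < r)
    (h : ∀ w, r ≤ W.graph.dist y w → W.ballGreen y R w ≤ M) {v w : V}
    (hw : r ≤ W.graph.dist y w) (hwR : (W.graph.dist y w : ℝ) < R) (hwv : W.graph.Adj w v) :
    W.ballGreen y R v ≤ M / p := by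
  have hwy : w ≠ y := by
    rintro rfl
    rw [SimpleGraph.dist_self, Nat.cast_zero] at hw
    linarith
  rw [le_div_iff₀' hp.pos]
  exact (hp.mul_le_of_adj (W.muLaplacian_green_of_ne (mem_ballFinset.2 hwR) hwy).le
    (fun _ _ => W.ballGreen_nonneg _ _ _) hwv).trans (h w hw)

theorem div_mul_ballGreen_le_of_superharmonic {y : V} {r R α N : ℝ} {s : V → ℝ} (hr : 0 < r)
    (hα : 0 ≤ α) (hN : 0 < N) (hnonneg : ∀ z, 0 ≤ s z)
    (hs : ∀ z, (W.graph.dist y z : ℝ) < R → W.muLaplacian s z ≤ 0)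
    (h : ∀ z, (W.graph.dist y z : ℝ) < r → α ≤ s z)
    (hgreen : ∀ w v, r ≤ W.graph.dist y w → (W.graph.dist y w : ℝ) < R → W.graph.Adj w v →
      W.ballGreen y R v ≤ N) {z : V} (hz : r ≤ W.graph.dist y z) :
    α / N * W.ballGreen y R z ≤ s z := by
  have hfar : ∀ v, R ≤ W.graph.dist y v → α / N * W.ballGreen y R v ≤ s v := fun v hv => by
    rw [W.ballGreen_of_le_dist hv, mul_zero]
    exact hnonneg v
  rcases le_or_gt R (W.graph.dist y z) with hzR | hzR
  · exact hfar z hzR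
  classical
  refine W.le_of_muLaplacian_le (A := {z ∈ W.ballFinset y R | r ≤ W.graph.dist y z})
    (u := (α / N) • W.ballGreen y R) (fun w hw => ?_) (fun w hw v hwv hv => ?_) z
    (Finset.mem_filter.2 ⟨mem_ballFinset.2 hzR, hz⟩)
  · obtain ⟨hwR, hwr⟩ := Finset.mem_filter.1 hw
    have hwy : w ≠ y := by
      rintro rfl
      rw [SimpleGraph.dist_self, Nat.cast_zero] at hwr
      linarith
    have hharmonic : W.muLaplacian (W.ballGreen y R) w = 0 := W.muLaplacian_green_of_ne hwR hwy
    rw [map_smul, Pi.smul_apply, hharmonic, smul_zero]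
    exact hs w (mem_ballFinset.1 hwR)
  · obtain ⟨hwR, hwr⟩ := Finset.mem_filter.1 hw
    rcases le_or_gt R (W.graph.dist y v) with hvR | hvR
    · exact hfar v hvR
    · have hvr : (W.graph.dist y v : ℝ) < r := not_le.1 fun hc =>
        hv (Finset.mem_filter.2 ⟨mem_ballFinset.2 hvR, hc⟩)
      calc α / N * W.ballGreen y R v ≤ α / N * N := mul_le_mul_of_nonneg_left
            (hgreen w v hwr (mem_ballFinset.1 hwR) hwv) (by positivity)
        _ = α := div_mul_cancel₀ α hN.ne'
        _ ≤ s v := h v hvr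

theorem GreenBounds.superharmonicGrowth (hp : W.Elliptic p) (hD : W.Doubling D)
    (hg : W.GreenBounds C c) : W.SuperharmonicGrowth (c * p / (2 * C * D)) := by
  have hC : 0 < C := zero_lt_one.trans_le hg.one_le
  have hD_pos : 0 < D := zero_lt_one.trans_le hD.one_le
  have hp_pos := hp.pos
  have hc := hg.pos
  refine ⟨by positivity, fun y r α s hr hα hnonneg hs h z hz => ?_⟩
  rcases lt_or_ge (W.graph.dist y z : ℝ) r with hzr | hzr
  · refine (mul_le_of_le_one_left hα ?_).trans (h z hzr)
    have hcp : c * p ≤ 1 := mul_le_one₀ hg.le_one hp_pos.le hp.le_one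
    have hCD : 1 ≤ C * D := one_le_mul_of_one_le_of_one_le hg.one_le hD.one_le
    rw [div_le_one (by positivity)]
    linarith
  · have hscale := W.greenScale_pos y (show 0 < 2 * r by positivity)
    have hupper : ∀ w, r ≤ W.graph.dist y w →
        W.ballGreen y (4 * r) w ≤ 2 * C * D * W.greenScale y (2 * r) := fun w hw =>
      calc W.ballGreen y (4 * r) w = W.ballGreen y (2 * (2 ^ 1 * r)) w := by ring_nf
        _ ≤ C * (2 * D) ^ 1 * W.greenScale y (2 ^ 1 * r) := hg.ballGreen_le hD y hr 1 hw
        _ = 2 * C * D * W.greenScale y (2 * r) := by ring_nf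
    have hlower : c * W.greenScale y (2 * r) ≤ W.ballGreen y (4 * r) z :=
      (hg.lower y (2 * r) (by positivity) z hz).trans_eq (by ring_nf)
    calc c * p / (2 * C * D) * α
        = α / (2 * C * D * W.greenScale y (2 * r) / p) * (c * W.greenScale y (2 * r)) := by
          field_simp
      _ ≤ α / (2 * C * D * W.greenScale y (2 * r) / p) * W.ballGreen y (4 * r) z :=
          mul_le_mul_of_nonneg_left hlower (by positivity)
      _ ≤ s z := div_mul_ballGreen_le_of_superharmonic hr hα (by positivity) hnonneg hs h
          (fun w v hw hwR hwv => hp.ballGreen_le_div hr hupper hw hwR hwv) hzr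

/- The walk started at `y` leaves `B(y,2R)` through `B(z,t)` with probability at least `q ^ (2n)`,
and `g^{B(z,2t)}(z,·)` is at least `c · greenScale z t` there; so its harmonic extension into
`B(y,2R)` is large at `y`, although it is at most a Green kernel of `B(y,2R)`. -/
theorem GreenBounds.greenScale_le_of_dist (hD : W.Doubling D) (hg : W.GreenBounds C c)
    (hq : W.SuperharmonicGrowth q) {y z : V} {R t r : ℝ} {n : ℕ} (hR : 0 < R) (ht : 0 < t)
    (hr : 1 ≤ r) (hRr : 2 * R + r ≤ W.graph.dist z y)
    (htr : W.graph.dist z y ≤ 2 * R + t - 8 * r) (hn : W.graph.dist z y ≤ n * r)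
    (htR : 2 * t + 1 + R / 4 ≤ W.graph.dist z y) :
    c * q ^ (2 * n) * W.greenScale z t ≤ C * (2 * D) ^ 2 * W.greenScale y R := by
  have hC : 0 < C := zero_lt_one.trans_le hg.one_le
  have hscale_z : 0 ≤ c * W.greenScale z t := (mul_pos hg.pos (W.greenScale_pos z ht)).le
  have hscale_y := W.greenScale_pos y hR
  have hgreen_y : W.ballGreen z (2 * t) y = 0 := W.ballGreen_of_le_dist (by linarith)
  have hbdry : ∀ w ∉ W.ballFinset y (2 * R),
      ((c * W.greenScale z t) • (W.ball z t).indicator (1 : V → ℝ)) w ≤ W.ballGreen z (2 * t) w :=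
    fun w _ => by
      by_cases hw : w ∈ W.ball z t
      · simpa [Set.indicator_of_mem hw] using hg.lower z t ht w hw
      · simpa [Set.indicator_of_notMem hw] using W.ballGreen_nonneg z (2 * t) w
  calc c * q ^ (2 * n) * W.greenScale z t = c * W.greenScale z t * q ^ (2 * n) := by ring
    _ ≤ c * W.greenScale z t * W.exitProb y (2 * R) z t y :=
        mul_le_mul_of_nonneg_left (hq.pow_le_exitProb hr hRr htr hn) hscale_z
    _ ≤ W.harmonicExtension (W.ballFinset y (2 * R)) (W.ballGreen z (2 * t)) y :=
        (W.harmonicExtension_smul _ _ y).symm.trans_le (W.harmonicExtension_mono hbdry y)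
    _ = W.greenPotential (W.ballFinset y (2 * R)) (W.muLaplacian (W.ballGreen z (2 * t))) y := by
        rw [harmonicExtension, Pi.add_apply, hgreen_y, zero_add]
    _ ≤ C * (2 * D) ^ 2 * W.greenScale y R :=
        W.greenPotential_muLaplacian_green_le (by positivity) fun v _ _ w hw hvw => by
          have hzv := W.cast_dist_le_add_one_of_adj (x := z) hvw.symm
          have hyv : R / 4 ≤ W.graph.dist y v := by
            linarith [mem_ballFinset.1 hw, W.cast_dist_triangle z v y, W.cast_dist_comm v y]
          simpa [ballGreen, show (2 : ℝ) ^ 2 * (R / 4) = R by ring] using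
            hg.ballGreen_le hD y (show 0 < R / 4 by positivity) 2 hyv

theorem GreenBounds.exists_greenScale_mul_le (hp : W.Elliptic p) (hD : W.Doubling D)
    (hg : W.GreenBounds C c) : ∃ K : ℝ, 0 < K ∧ ∀ (y : V) (R : ℝ), 80 ≤ R →
      W.greenScale y (13 / 10 * R) ≤ K * W.greenScale y R := by
  have hq := hg.superharmonicGrowth hp hD
  set q := c * p / (2 * C * D)
  have hC : 0 < C := zero_lt_one.trans_le hg.one_le
  have hD_pos : 0 < D := zero_lt_one.trans_le hD.one_le
  have hlow : 0 < c * q ^ (2 * 320) := mul_pos hg.pos (pow_pos hq.pos _)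
  set κ := C * (2 * D) ^ 2 / (c * q ^ (2 * 320)) with hκ
  have hκ_pos : 0 < κ := by positivity
  have hstep : ∀ (y z : V) (R t : ℝ), 80 ≤ R → W.graph.dist z y = ⌈3 * R⌉₊ → t = 13 / 10 * R →
      W.greenScale z t ≤ κ * W.greenScale y R ∧ W.greenScale z t ≤ κ * W.greenScale y t := by
    intro y z R t hR hz ht
    have hle : 3 * R ≤ W.graph.dist z y := hz ▸ Nat.le_ceil (3 * R)
    have hlt : (W.graph.dist z y : ℝ) < 3 * R + 1 := hz ▸ Nat.ceil_lt_add_one (by linarith)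
    rw [hκ, div_mul_eq_mul_div, div_mul_eq_mul_div, le_div_iff₀' hlow, le_div_iff₀' hlow]
    constructor <;>
    exact hg.greenScale_le_of_dist hD hq (r := R / 80) (n := 320) (by linarith) (by linarith)
      (by linarith) (by linarith) (by linarith) (by push_cast; linarith) (by linarith)
  refine ⟨κ * κ, by positivity, fun y R hR => ?_⟩
  obtain ⟨z, hz⟩ := W.exists_dist_eq y ⌈3 * R⌉₊
  calc W.greenScale y (13 / 10 * R) ≤ κ * W.greenScale z (13 / 10 * R) :=
        (hstep z y R _ hR hz rfl).2
    _ ≤ κ * (κ * W.greenScale y R) := mul_le_mul_of_nonneg_left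
        (hstep y z R _ hR (SimpleGraph.dist_comm.trans hz) rfl).1 hκ_pos.le
    _ = κ * κ * W.greenScale y R := (mul_assoc _ _ _).symm

theorem le_pow_mul_of_forall_le_mul {F : ℝ → ℝ} {lam K R₀ R : ℝ} (hlam : 1 ≤ lam) (hK : 0 ≤ K)
    (hR₀ : 0 ≤ R₀) (h : ∀ R, R₀ ≤ R → F (lam * R) ≤ K * F R) (hR : R₀ ≤ R) (n : ℕ) :
    F (lam ^ n * R) ≤ K ^ n * F R := by
  induction n with
  | zero => simp
  | succ n ih =>
    have hRn : R₀ ≤ lam ^ n * R :=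
      hR.trans (le_mul_of_one_le_left (hR₀.trans hR) (one_le_pow₀ hlam))
    calc F (lam ^ (n + 1) * R) = F (lam * (lam ^ n * R)) := by rw [pow_succ', mul_assoc]
      _ ≤ K * F (lam ^ n * R) := h _ hRn
      _ ≤ K * (K ^ n * F R) := mul_le_mul_of_nonneg_left ih hK
      _ = K ^ (n + 1) * F R := by rw [pow_succ', mul_assoc]

theorem GreenBounds.exists_greenScale_two_mul_le (hp : W.Elliptic p) (hD : W.Doubling D)
    (hg : W.GreenBounds C c) : ∃ K : ℝ, 0 < K ∧ ∀ (y : V) (r : ℝ), 640 ≤ r →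
      W.greenScale y (2 * r) ≤ K * W.greenScale y (r / 8) := by
  have hD_pos : 0 < D := zero_lt_one.trans_le hD.one_le
  obtain ⟨K, hK, hstep⟩ := hg.exists_greenScale_mul_le hp hD
  refine ⟨D * K ^ 11, by positivity, fun y r hr => ?_⟩
  calc W.greenScale y (2 * r) ≤ D * W.greenScale y ((13 / 10) ^ 11 * (r / 8)) :=
        hD.greenScale_le y (by linarith) (by norm_num; linarith) (by norm_num; linarith)
    _ ≤ D * (K ^ 11 * W.greenScale y (r / 8)) := mul_le_mul_of_nonneg_left
        (le_pow_mul_of_forall_le_mul (F := W.greenScale y) (by norm_num) hK.le (by norm_num)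
          (hstep y) (by linarith) 11) hD_pos.le
    _ = D * K ^ 11 * W.greenScale y (r / 8) := (mul_assoc _ _ _).symm

end GreenScale

section GreenComparison

variable {V : Type*} {W : WeightedGraph V} [W.graph.LocallyFinite] [Infinite V] {x a b z : V}
  {r s K D C c q : ℝ}

theorem green_le_mul_green_of_annulus {A : Finset V} (ha : W.graph.dist x a ≤ s)
    (hb : W.graph.dist x b ≤ s) (hrs : r + 1 ≤ s)
    (h : ∀ z, r ≤ W.graph.dist x z → W.graph.dist x z ≤ s → W.green A a z ≤ K * W.green A b z)
    (hz : r ≤ W.graph.dist x z) : W.green A a z ≤ K * W.green A b z := by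
  rcases le_or_gt (W.graph.dist x z : ℝ) s with hzs | hzs
  · exact h z hz hzs
  have houtside : ∀ v ∉ A, W.green A a v ≤ K * W.green A b v := fun v hv => by
    rw [W.green_of_notMem_right a hv, W.green_of_notMem_right b hv, mul_zero]
  by_cases hzA : z ∈ A
  · have hharmonic : ∀ e, W.graph.dist x e ≤ s → ∀ w ∈ A, s < W.graph.dist x w →
        W.muLaplacian (W.green A e) w = 0 := fun e he w hw hsw =>
      W.muLaplacian_green_of_ne hw fun hwe => (hwe ▸ hsw).not_ge he
    classical
    refine W.le_of_muLaplacian_le (A := {w ∈ A | s < W.graph.dist x w}) (u := W.green A a)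
      (v := K • W.green A b) (fun w hw => ?_) (fun w hw v hwv hv => ?_) z
      (Finset.mem_filter.2 ⟨hzA, hzs⟩)
    · obtain ⟨hwA, hsw⟩ := Finset.mem_filter.1 hw
      rw [map_smul, Pi.smul_apply, hharmonic a ha w hwA hsw, hharmonic b hb w hwA hsw, smul_zero]
    · by_cases hvA : v ∈ A
      · have hwv' := W.cast_dist_le_add_one_of_adj (x := x) hwv.symm
        exact h v (by linarith [(Finset.mem_filter.1 hw).2])
          (not_lt.1 fun hsv => hv (Finset.mem_filter.2 ⟨hvA, hsv⟩))
      · exact houtside v hvA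
  · exact houtside z hzA

theorem GreenBounds.green_le_greenScale (hD : W.Doubling D) (hg : W.GreenBounds C c) (hr : 0 < r)
    (ha : W.graph.dist x a < r / 2) (hz : r ≤ W.graph.dist x z)
    (hz' : W.graph.dist x z ≤ 3 / 2 * r) :
    W.green (W.ballFinset x (2 * r)) a z ≤ C * (2 * D) ^ 2 * W.greenScale z (2 * r) := by
  have hsubset : W.ballFinset x (2 * r) ⊆ W.ballFinset z (2 * (2 * r)) :=
    W.ballFinset_subset (by linarith [W.cast_dist_comm z x])
  have hza : r / 2 ≤ W.graph.dist z a := by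
    linarith [W.cast_dist_triangle x a z, W.cast_dist_comm a z]
  calc W.green (W.ballFinset x (2 * r)) a z = W.green (W.ballFinset x (2 * r)) z a :=
        W.green_symm _ a z
    _ ≤ W.ballGreen z (2 * (2 ^ 2 * (r / 2))) a := by
        rw [show (2 : ℝ) ^ 2 * (r / 2) = 2 * r by ring]
        exact W.green_mono hsubset z a
    _ ≤ C * (2 * D) ^ 2 * W.greenScale z (2 ^ 2 * (r / 2)) :=
        hg.ballGreen_le hD z (by linarith) 2 hza
    _ = C * (2 * D) ^ 2 * W.greenScale z (2 * r) := by ring_nf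

theorem GreenBounds.greenScale_le_green (hg : W.GreenBounds C c) (hq : W.SuperharmonicGrowth q)
    (hr : 8 ≤ r) (hb : W.graph.dist x b < r / 2) (hz : W.graph.dist x z ≤ 3 / 2 * r) :
    q ^ 32 * (c * W.greenScale z (r / 8)) ≤ W.green (W.ballFinset x (2 * r)) b z := by
  set U := W.ballFinset x (2 * r)
  have hscale : 0 ≤ c * W.greenScale z (r / 8) :=
    (mul_pos hg.pos (W.greenScale_pos z (by linarith))).le
  have hpow : ∀ n, 0 ≤ q ^ n := fun n => (pow_pos hq.pos n).le
  have hsuper : ∀ v, W.graph.dist x v ≤ 3 / 2 * r → ∀ w, (W.graph.dist v w : ℝ) < 4 * (r / 8) →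
      W.muLaplacian (W.green U z) w ≤ 0 := fun v hv w hw =>
    W.muLaplacian_green_nonpos z (mem_ballFinset.2 (by linarith [W.cast_dist_triangle x v w]))
  have hinterval : ∀ y, W.graph.dist x y ≤ 3 / 2 * r → ∀ v ∈ W.geodesicInterval x y,
      W.graph.dist x v ≤ 3 / 2 * r := fun y hy v hv =>
    (Nat.cast_le.2 (Nat.le.intro hv)).trans hy
  have hz_near : ∀ w, (W.graph.dist z w : ℝ) < r / 8 →
      c * W.greenScale z (r / 8) ≤ W.green U z w := fun w hw =>
    (hg.lower z (r / 8) (by linarith) w hw).trans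
      (W.green_mono (W.ballFinset_subset (by linarith)) z w)
  have hx_near := hq.pow_mul_le_of_near_geodesics (a := z) (b := x) (n := 12)
    (by linarith) hscale (W.green_nonneg U z) (by push_cast; linarith [W.cast_dist_comm x z])
    (fun v hv => hsuper v (hinterval z hz v (W.geodesicInterval_comm z x ▸ hv))) hz_near
  have hb_near := hq.pow_mul_le_of_near_geodesics (a := x) (b := b) (n := 4)
    (by linarith) (mul_nonneg (hpow _) hscale) (W.green_nonneg U z) (by push_cast; linarith)
    (fun v hv => hsuper v (hinterval b (by linarith) v hv)) hx_near b
    (by rw [SimpleGraph.dist_self, Nat.cast_zero]; linarith)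
  calc q ^ 32 * (c * W.greenScale z (r / 8))
      = q ^ (2 * 4) * (q ^ (2 * 12) * (c * W.greenScale z (r / 8))) := by ring
    _ ≤ W.green U z b := hb_near
    _ = W.green U b z := W.green_symm U z b

theorem GreenBounds.exists_green_le_mul_green {p : ℝ} (hp : W.Elliptic p) (hD : W.Doubling D)
    (hg : W.GreenBounds C c) :
    ∃ K : ℝ, 0 < K ∧ ∀ (x a b z : V) (r : ℝ), 640 ≤ r → W.graph.dist x a < r / 2 →
      W.graph.dist x b < r / 2 → r ≤ W.graph.dist x z →
      W.green (W.ballFinset x (2 * r)) a z ≤ K * W.green (W.ballFinset x (2 * r)) b z := by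
  obtain ⟨K, hK, hscale⟩ := hg.exists_greenScale_two_mul_le hp hD
  have hq := hg.superharmonicGrowth hp hD
  set q := c * p / (2 * C * D)
  have hq_pos := hq.pos
  have hc := hg.pos
  have hC : 0 < C := zero_lt_one.trans_le hg.one_le
  have hD_pos : 0 < D := zero_lt_one.trans_le hD.one_le
  refine ⟨C * (2 * D) ^ 2 * K / (q ^ 32 * c), by positivity, fun x a b z r hr ha hb hz => ?_⟩
  refine green_le_mul_green_of_annulus (s := 3 / 2 * r) (by linarith) (by linarith) (by linarith)
    (fun y hy hy' => ?_) hz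
  calc W.green (W.ballFinset x (2 * r)) a y ≤ C * (2 * D) ^ 2 * W.greenScale y (2 * r) :=
        hg.green_le_greenScale hD (by linarith) ha hy hy'
    _ ≤ C * (2 * D) ^ 2 * (K * W.greenScale y (r / 8)) :=
        mul_le_mul_of_nonneg_left (hscale y r hr) (by positivity)
    _ = C * (2 * D) ^ 2 * K / (q ^ 32 * c) * (q ^ 32 * (c * W.greenScale y (r / 8))) := by
        field_simp
    _ ≤ C * (2 * D) ^ 2 * K / (q ^ 32 * c) * W.green (W.ballFinset x (2 * r)) b y :=
        mul_le_mul_of_nonneg_left (hg.greenScale_le_green hq (by linarith) hb hy') (by positivity)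

end GreenComparison

section EllipticHarnack

variable {V : Type*} {W : WeightedGraph V}

theorem le_inv_pow_mul_of_forall_mul_le {u : V → ℝ} {x y z : V} {R q : ℝ} {k n : ℕ} (hq : 0 < q)
    (hnk : R ≤ n * k) (hnonneg : ∀ w ∈ W.ball x R, 0 ≤ u w)
    (hstep : ∀ a ∈ W.ball x R, ∀ b ∈ W.ball x R, W.graph.dist a b ≤ k → q * u a ≤ u b)
    (hy : y ∈ W.ball x R) (hz : z ∈ W.ball x R) : u y ≤ q⁻¹ ^ (2 * n) * u z := by
  have hball : ∀ b ∈ W.ball x R, ∀ v ∈ W.geodesicInterval x b, v ∈ W.ball x R :=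
    fun b (hb : (W.graph.dist x b : ℝ) < R) v hv => (Nat.cast_le.2 (Nat.le.intro hv)).trans_lt hb
  have hdist : ∀ b ∈ W.ball x R, W.graph.dist x b ≤ n * k := fun b hb => by
    exact_mod_cast (hb.trans_le hnk).le
  have hchain : ∀ a b, W.geodesicInterval a b ⊆ W.ball x R → W.graph.dist a b ≤ n * k →
      a ∈ W.ball x R → q ^ n * u a ≤ u b := fun a b hab habnk ha =>
    W.geodesic_chain (P := fun v α => α ≤ u v) hq.le
      (fun v hv w hw hvw α _ hα =>
        (mul_le_mul_of_nonneg_left hα hq.le).trans (hstep v (hab hv) w (hab hw) hvw))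
      habnk (hnonneg a ha) le_rfl
  have hx : x ∈ W.ball x R := by
    change (W.graph.dist x x : ℝ) < R
    rw [SimpleGraph.dist_self, Nat.cast_zero]
    exact (Nat.cast_nonneg _).trans_lt hy
  have hyx : q ^ n * u y ≤ u x :=
    hchain y x (W.geodesicInterval_comm x y ▸ hball y hy) (SimpleGraph.dist_comm ▸ hdist y hy) hy
  have hxz : q ^ n * u x ≤ u z := hchain x z (hball z hz) (hdist z hz) hx
  rw [inv_pow, inv_mul_eq_div, le_div_iff₀' (pow_pos hq _)]
  calc q ^ (2 * n) * u y = q ^ n * (q ^ n * u y) := by ring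
    _ ≤ q ^ n * u x := mul_le_mul_of_nonneg_left hyx (pow_pos hq n).le
    _ ≤ u z := hxz

variable [W.graph.LocallyFinite] [Infinite V] {p D C c : ℝ}

/- Off `A` the function `u` is replaced by `0`, which turns it into the Green potential of a charge
carried by the points of `A` with a neighbour outside `A`. -/
theorem le_mul_of_green_le_mul_green {A : Finset V} {u : V → ℝ} {a b : V} {K : ℝ}
    (hu : ∀ z ∈ A, W.muLaplacian u z = 0) (hnonneg : ∀ z ∈ A, ∀ w, W.graph.Adj z w → 0 ≤ u w)
    (ha : a ∈ A) (hb : b ∈ A)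
    (hgreen : ∀ z ∈ A, ∀ w ∉ A, W.graph.Adj z w → W.green A a z ≤ K * W.green A b z) :
    u a ≤ K * u b := by
  set f : V → ℝ := (A : Set V).indicator u
  have hf : ∀ z ∈ A, f z = u z := fun z hz => Set.indicator_of_mem (Finset.mem_coe.2 hz) u
  have hf_zero : ∀ z ∉ A, f z = 0 := fun z hz => Set.indicator_of_notMem (mt Finset.mem_coe.1 hz) u
  have hf_le : ∀ z ∈ A, W.muLaplacian f z ≤ 0 := fun z hz => by
    rw [← hu z hz]
    refine W.muLaplacian_mono (hf z hz) fun w hw => ?_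
    by_cases hwA : w ∈ A
    · exact (hf w hwA).le
    · exact (hf_zero w hwA).trans_le (hnonneg z hz w hw)
  have hsum : ∑ z ∈ A, K * (W.green A b z * W.muLaplacian f z)
      ≤ ∑ z ∈ A, W.green A a z * W.muLaplacian f z := Finset.sum_le_sum fun z hz => by
    rw [← mul_assoc]
    by_cases hbdry : ∃ w ∉ A, W.graph.Adj z w
    · obtain ⟨w, hw, hzw⟩ := hbdry
      exact mul_le_mul_of_nonpos_right (hgreen z hz w hw hzw) (hf_le z hz)
    · have hzero : W.muLaplacian f z = 0 := (W.muLaplacian_congr (hf z hz) fun w hw =>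
        hf w (by_contra fun hwA => hbdry ⟨w, hwA, hw⟩)).trans (hu z hz)
      rw [hzero, mul_zero, mul_zero]
  rw [← Finset.mul_sum, W.sum_green_mul_muLaplacian hf_zero ha,
    W.sum_green_mul_muLaplacian hf_zero hb, hf a ha, hf b hb] at hsum
  linarith

theorem GreenBounds.exists_mul_le_of_dist_lt (hp : W.Elliptic p) (hD : W.Doubling D)
    (hg : W.GreenBounds C c) :
    ∃ q : ℝ, 0 < q ∧ ∀ (x a b : V) (r : ℝ) (u : V → ℝ), 640 ≤ r → W.graph.dist x a < r / 2 →
      W.graph.dist x b < r / 2 → (∀ z ∈ W.ball x (2 * r), W.muLaplacian u z = 0) →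
      (∀ z ∈ W.ball x (2 * r), ∀ w, W.graph.Adj z w → 0 ≤ u w) → q * u a ≤ u b := by
  obtain ⟨K, hK, hgreen⟩ := hg.exists_green_le_mul_green hp hD
  refine ⟨K⁻¹, inv_pos.2 hK, fun x a b r u hr ha hb hu hnonneg => ?_⟩
  rw [inv_mul_le_iff₀ hK]
  refine le_mul_of_green_le_mul_green (A := W.ballFinset x (2 * r))
    (fun z hz => hu z (mem_ballFinset.1 hz)) (fun z hz => hnonneg z (mem_ballFinset.1 hz))
    (mem_ballFinset.2 (by linarith)) (mem_ballFinset.2 (by linarith))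
    fun z _ w hw hzw => hgreen x a b z r hr ha hb ?_
  rw [mem_ballFinset, not_lt] at hw
  linarith [W.cast_dist_le_add_one_of_adj (x := x) hzw]

theorem GreenBounds.ellipticHarnack (hp : W.Elliptic p) (hD : W.Doubling D)
    (hg : W.GreenBounds C c) : W.EllipticHarnack := by
  obtain ⟨q, hq, hmul_le⟩ := hg.exists_mul_le_of_dist_lt hp hD
  have hlarge : 0 < q⁻¹ ^ (2 * 8) := pow_pos (inv_pos.2 hq) _
  have hsmall : 0 < p⁻¹ ^ (2 * 1280) := pow_pos (inv_pos.2 hp.pos) _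
  refine ⟨1 + p⁻¹ ^ (2 * 1280) + q⁻¹ ^ (2 * 8), by linarith,
    fun x R hR u hu hu_nonneg y hy z hz => ?_⟩
  have hharmonic := W.harmonicOn_iff.1 hu
  have hnonneg_adj : ∀ w ∈ W.ball x (2 * R), ∀ v, W.graph.Adj w v → 0 ≤ u v :=
    fun w hw v hv => hu_nonneg v (Or.inr ⟨w, hw, hv⟩)
  have hball : W.ball x R ⊆ W.ball x (2 * R) := fun w (hw : (W.graph.dist x w : ℝ) < R) =>
    hw.trans (by linarith)
  have hnonneg : ∀ w ∈ W.ball x R, 0 ≤ u w := fun w hw => hu_nonneg w (Or.inl (hball hw))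
  rcases lt_or_ge R 1280 with hR' | hR'
  · calc u y ≤ p⁻¹ ^ (2 * 1280) * u z :=
          le_inv_pow_mul_of_forall_mul_le (k := 1) hp.pos (by push_cast; linarith) hnonneg
            (fun a _ b hb hab => hp.mul_le_of_dist_le_one (hharmonic b (hball hb)).le
              (hnonneg b hb) (hnonneg_adj b (hball hb)) hab) hy hz
      _ ≤ _ := mul_le_mul_of_nonneg_right (by linarith) (hnonneg z hz)
  · have hsteps : R ≤ (8 : ℕ) * (⌊R / 8⌋₊ + 1 : ℕ) := by
      push_cast
      linarith [Nat.lt_floor_add_one (R / 8)]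
    calc u y ≤ q⁻¹ ^ (2 * 8) * u z := by
          refine le_inv_pow_mul_of_forall_mul_le hq hsteps hnonneg (fun a ha b _ hab => ?_) hy hz
          have hab_lt : (W.graph.dist a b : ℝ) < R / 2 / 2 := by
            have hab' : (W.graph.dist a b : ℝ) ≤ (⌊R / 8⌋₊ + 1 : ℕ) := Nat.cast_le.2 hab
            push_cast at hab'
            linarith [Nat.floor_le (show 0 ≤ R / 8 by linarith)]
          have hsubset : W.ball a (2 * (R / 2)) ⊆ W.ball x (2 * R) := fun w hw => by
            simp only [ball, Set.mem_ofPred_eq] at ha hw ⊢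
            linarith [W.cast_dist_triangle x a w]
          exact hmul_le a a b (R / 2) u (by linarith) (by simp; linarith) hab_lt
            (fun w hw => hharmonic w (hsubset hw)) (fun w hw => hnonneg_adj w (hsubset hw))
      _ ≤ _ := mul_le_mul_of_nonneg_right (by linarith) (hnonneg z hz)

end EllipticHarnack

end WeightedGraph

theorem mainTheorem5 {V : Type*} [Infinite V] [Countable V]
    [MeasurableSpace V] [DiscreteMeasurableSpace V] (W : WeightedGraph V)
    (hp₀ : W.ControlledWeights) (hVD : W.VolumeDoubling) :
    W.GreenKernelBounds ↔ W.EllipticHarnack ∧ W.EinsteinRelation := by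
  obtain ⟨p, hp⟩ := hp₀.exists_elliptic
  let _ : W.graph.LocallyFinite := fun x => (hp.finite_neighborSet x).fintype
  obtain ⟨D, hD⟩ := hVD.exists_doubling
  constructor
  · intro h
    obtain ⟨C, c, hg⟩ := W.greenKernelBounds_iff.1 h
    exact ⟨hg.ellipticHarnack hp hD, hg.einsteinRelation hp hD⟩
  · rintro ⟨hH, hE⟩
    obtain ⟨H, hH⟩ := hH.exists_harnack
    obtain ⟨C, hC, hscale⟩ := hE.exists_greenScale_le hD
    exact W.greenKernelBounds_iff.2 ⟨_, _, hH.greenBounds hp hC hscale⟩
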